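/- Let $G$ be a countable discrete group and let $\mathcal H=\{H_i\}_{i\in I}$ be a nonempty finite family of subgroups of $G$. Then $G$ is relatively amenable with respect to $\mathcal H$ if and only if, for every $G$-Banach space $E$ and every $n\ge 0$, the map $$H^n_b(\mathcal H;E^*)\longrightarrow H^{n+1}_b(G,\mathcal H;E^*)$$ of the long exact sequence in relative bounded cohomology is surjective. Here the terms are as follows. *Relative amenability.* $G$ is relatively amenable with respect to $\mathcal H$ if there are a countable $G$-set $K$ with finitely many orbits, whose point stabilizers are precisely the conjugates of the members of $\mathcal H$, and a sequence of finitely supported functions $f^m:K\to[0,\infty)$ with $\sum_{k\in K} f^m(k)=1$ such that $\|f^m-g f^m\|_{\ell^1(K)}\to 0$ as $m\to\infty$ for every $g\in G$. (This is the case $X=\mathrm{pt}$ of the notion of an action of $G$ on a compact Hausdorff space $X$ being amenable relative to $\mathcal H$, in which $f^m$ is a finitely supported function $K\to C(X)$, $f^m_k\ge 0$, $\sum_k f^m_k=1_X$, and the norm is $\|f\|_V=\sup_{x\in X}\sum_{k\in K}|f_k(x)|$.) *Coefficients.* A $G$-Banach space is a complex Banach space with a linear isometric action of $G$; its dual $E^*$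 carries the contragredient action. For isometric $G$-modules $U,V$, $\operatorname{bHom}(U,V)$ is the space of bounded linear maps with the operator norm and the action $(g\cdot T)(u)=g\,T(g^{-1}u)$. *Bounded cohomology.* For an isometric $G$-module $V$, $H^n_b(G;V)$ is the $n$-th cohomology of the complex of bounded functions $f:G^{n+1}\to V$ with $f(gx_0,\dots,gx_n)=g f(x_0,\dots,x_n)$ and the homogeneous coboundary $(df)(x_0,\dots,x_{n+1})=\sum_j(-1)^j f(x_0,\dots,\widehat{x_j},\dots,x_{n+1})$. Put $H^n_b(\mathcal H;V)=\prod_{i\in I}H^n_b(H_i;V)$. *Relative bounded cohomology.* Let $G/\mathcal H=\coprod_{i\in I}G/H_i$, let $\mathbb C[G/\mathcal H]$ be the space of finitely supported complex functions on it with the $\ell^1$-norm, and let $\Delta$ be the kernel of the augmentation $\varepsilon(f)=\sum_x f(x)$, with the restricted norm. Then $H^{n+1}_b(G,\mathcal H;V)=H^n_b(G;\operatorname{bHom}(\Delta,V))$. The map $H^n_b(\mathcal H;V)\to H^{n+1}_b(G,\mathcal H;V)$ is the composite of the Eckmann–Shapiro isomorphism $H^n_b(\mathcal H;V)\cong H^n_b(G;\operatorname{bHom}(\mathbb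 C[G/\mathcal H],V))$ with the map induced by restriction $\operatorname{bHom}(\mathbb C[G/\mathcal H],V)\to\operatorname{bHom}(\Delta,V)$. -/

import Mathlib

open Filter Topology
open scoped ENNReal

universe u v w

noncomputable section

/-! ### Isometric representations -/

/-- A linear isometric action of a (discrete) group `G` on a complex normed space `V`.
A `G`-Banach space is a Banach space together with such an action. -/
abbrev IsomRep (G V : Type*) [Group G] [NormedAddCommGroup V] [NormedSpace ℂ V] :=
  G →* (V ≃ₗᵢ[ℂ] V)

namespace IsomRep

variable {G U V : Type*} [Group G] [NormedAddCommGroup U] [NormedSpace ℂ U]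
  [NormedAddCommGroup V] [NormedSpace ℂ V]

theorem mul_apply (ρ : IsomRep G V) (g h : G) (v : V) : ρ (g * h) v = ρ g (ρ h v) := by
  rw [map_mul]; rfl

theorem one_apply (ρ : IsomRep G V) (v : V) : ρ 1 v = v := by
  rw [map_one]; rfl

theorem inv_apply_self (ρ : IsomRep G V) (g : G) (v : V) : ρ g⁻¹ (ρ g v) = v := by
  rw [← mul_apply, inv_mul_cancel, one_apply]

theorem self_apply_inv (ρ : IsomRep G V) (g : G) (v : V) : ρ g (ρ g⁻¹ v) = v := by
  rw [← mul_apply, mul_inv_cancel, one_apply]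

/-- The action of a single group element on the space of bounded linear maps:
`T ↦ g ∘ T ∘ g⁻¹`. -/
def bHomFun (σ : IsomRep G U) (ρ : IsomRep G V) (g : G) : (U →L[ℂ] V) →ₗ[ℂ] (U →L[ℂ] V) where
  toFun T := ((ρ g).toContinuousLinearEquiv : V →L[ℂ] V) ∘L T ∘L
    ((σ g⁻¹).toContinuousLinearEquiv : U →L[ℂ] U)
  map_add' S T := by ext u; simp
  map_smul' c T := by ext u; simp

theorem bHomFun_apply (σ : IsomRep G U) (ρ : IsomRep G V) (g : G) (T : U →L[ℂ] V) (u : U) :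
    bHomFun σ ρ g T u = ρ g (T (σ g⁻¹ u)) := rfl

theorem bHomFun_mul (σ : IsomRep G U) (ρ : IsomRep G V) (g h : G) (T : U →L[ℂ] V) :
    bHomFun σ ρ (g * h) T = bHomFun σ ρ g (bHomFun σ ρ h T) := by
  ext u
  simp only [bHomFun_apply, mul_inv_rev, mul_apply]

theorem bHomFun_one (σ : IsomRep G U) (ρ : IsomRep G V) (T : U →L[ℂ] V) :
    bHomFun σ ρ 1 T = T := by
  ext u
  simp only [bHomFun_apply, inv_one, one_apply]

theorem norm_bHomFun_le (σ : IsomRep G U) (ρ : IsomRep G V) (g : G) (T : U →L[ℂ] V) :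
    ‖bHomFun σ ρ g T‖ ≤ ‖T‖ := by
  refine ContinuousLinearMap.opNorm_le_bound _ (norm_nonneg _) fun u => ?_
  rw [bHomFun_apply, LinearIsometryEquiv.norm_map]
  exact (T.le_opNorm _).trans_eq (by rw [LinearIsometryEquiv.norm_map])

/-- The isometric action of `G` on `bHom(U, V)`, the space of bounded linear maps with the
operator norm: `(g • T) u = g • T (g⁻¹ • u)`. -/
def bHom (σ : IsomRep G U) (ρ : IsomRep G V) : IsomRep G (U →L[ℂ] V) where
  toFun g :=
    { toLinearEquiv := LinearEquiv.ofLinearMap (bHomFun σ ρ g) (bHomFun σ ρ g⁻¹)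
        (by ext1 T; simp [← bHomFun_mul, bHomFun_one])
        (by ext1 T; simp [← bHomFun_mul, bHomFun_one])
      norm_map' := fun T => by
        refine le_antisymm (norm_bHomFun_le σ ρ g T) ?_
        have h := norm_bHomFun_le σ ρ g⁻¹ (bHomFun σ ρ g T)
        rwa [← bHomFun_mul, inv_mul_cancel, bHomFun_one] at h }
  map_one' := by ext1 T; exact bHomFun_one σ ρ T
  map_mul' g h := by ext1 T; exact bHomFun_mul σ ρ g h T

theorem bHom_apply (σ : IsomRep G U) (ρ : IsomRep G V) (g : G) (T : U →L[ℂ] V) (u : U) :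
    bHom σ ρ g T u = ρ g (T (σ g⁻¹ u)) := rfl

/-- The contragredient action of `G` on the Banach dual `V*`: `(g • φ) v = φ (g⁻¹ • v)`. -/
def dual (ρ : IsomRep G V) : IsomRep G (V →L[ℂ] ℂ) := bHom ρ (1 : IsomRep G ℂ)

theorem dual_apply (ρ : IsomRep G V) (g : G) (φ : V →L[ℂ] ℂ) (v : V) :
    dual ρ g φ v = φ (ρ g⁻¹ v) := rfl

/-- Restriction of an isometric action to a subgroup. -/
abbrev res (ρ : IsomRep G V) (H : Subgroup G) : IsomRep H V := ρ.comp H.subtype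

end IsomRep

/-! ### Bounded cohomology -/

section BoundedCohomology

variable {G V W : Type*} [Group G] [NormedAddCommGroup V] [NormedSpace ℂ V]
  [NormedAddCommGroup W] [NormedSpace ℂ W]

/-- The space of bounded homogeneous `n`-cochains: the bounded functions `f : G^(n+1) → V` with
`f (g x₀, …, g xₙ) = g • f (x₀, …, xₙ)`. -/
def bddCochains (ρ : IsomRep G V) (n : ℕ) : Submodule ℂ ((Fin (n + 1) → G) → V) where
  carrier := {f | (∃ C : ℝ, ∀ x, ‖f x‖ ≤ C) ∧ ∀ g x, f (fun j => g * x j) = ρ g (f x)}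
  zero_mem' := ⟨⟨0, fun x => by simp⟩, fun g x => by simp⟩
  add_mem' := by
    rintro f₁ f₂ ⟨⟨C₁, h₁⟩, e₁⟩ ⟨⟨C₂, h₂⟩, e₂⟩
    refine ⟨⟨C₁ + C₂, fun x => (norm_add_le _ _).trans (add_le_add (h₁ x) (h₂ x))⟩, fun g x => ?_⟩
    simp only [Pi.add_apply, e₁, e₂, map_add]
  smul_mem' := by
    rintro c f ⟨⟨C, h⟩, e⟩
    refine ⟨⟨‖c‖ * C, fun x => ?_⟩, fun g x => ?_⟩
    · rw [Pi.smul_apply, norm_smul]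
      exact mul_le_mul_of_nonneg_left (h x) (norm_nonneg c)
    · simp only [Pi.smul_apply, e, map_smul]

/-- The space of bounded homogeneous `n`-cochains, as a type. -/
def BddCochain (ρ : IsomRep G V) (n : ℕ) : Type _ := bddCochains ρ n

instance (ρ : IsomRep G V) (n : ℕ) : AddCommGroup (BddCochain ρ n) :=
  inferInstanceAs (AddCommGroup (bddCochains ρ n))

instance (ρ : IsomRep G V) (n : ℕ) : Module ℂ (BddCochain ρ n) :=
  inferInstanceAs (Module ℂ (bddCochains ρ n))

namespace BddCochain

variable {ρ : IsomRep G V} {n : ℕ}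

theorem ext {f f' : BddCochain ρ n} (h : ∀ x, f.1 x = f'.1 x) : f = f' :=
  Subtype.ext (funext h)

theorem zero_val (x : Fin (n + 1) → G) : (0 : BddCochain ρ n).1 x = 0 := rfl

theorem add_val (f f' : BddCochain ρ n) (x : Fin (n + 1) → G) :
    (f + f').1 x = f.1 x + f'.1 x := rfl

theorem smul_val (c : ℂ) (f : BddCochain ρ n) (x : Fin (n + 1) → G) :
    (c • f).1 x = c • f.1 x := rfl

end BddCochain

/-- The homogeneous coboundary
`(d f) (x₀, …, xₙ₊₁) = ∑ i, (-1)^i f (x₀, …, x̂ᵢ, …, xₙ₊₁)` on all functions. -/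
def coboundaryFun (G V : Type*) [NormedAddCommGroup V] [NormedSpace ℂ V] (n : ℕ) :
    ((Fin (n + 1) → G) → V) →ₗ[ℂ] ((Fin (n + 2) → G) → V) where
  toFun f x := ∑ i : Fin (n + 2), (-1 : ℂ) ^ (i : ℕ) • f (fun j => x (i.succAbove j))
  map_add' f₁ f₂ := by ext x; simp [Finset.sum_add_distrib]
  map_smul' c f := by ext x; simp [Finset.smul_sum, smul_comm c]

theorem coboundaryFun_apply {G V : Type*} [NormedAddCommGroup V] [NormedSpace ℂ V] (n : ℕ) (f : (Fin (n + 1) → G) → V) (x : Fin (n + 2) → G) :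
    coboundaryFun G V n f x =
      ∑ i : Fin (n + 2), (-1 : ℂ) ^ (i : ℕ) • f (fun j => x (i.succAbove j)) := rfl

theorem coboundaryFun_mem (ρ : IsomRep G V) (n : ℕ) (f : (Fin (n + 1) → G) → V)
    (hf : f ∈ bddCochains ρ n) : coboundaryFun G V n f ∈ bddCochains ρ (n + 1) := by
  obtain ⟨⟨C, hC⟩, he⟩ := hf
  refine ⟨⟨∑ _i : Fin (n + 2), C, fun x => ?_⟩, fun g x => ?_⟩
  · rw [coboundaryFun_apply]
    refine (norm_sum_le _ _).trans (Finset.sum_le_sum fun i _ => ?_)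
    rw [norm_smul]
    simpa using hC _
  · simp only [coboundaryFun_apply, map_sum, map_smul]
    exact Finset.sum_congr rfl fun i _ => by rw [← he]

/-- The coboundary on bounded cochains. -/
def coboundary (ρ : IsomRep G V) (n : ℕ) : BddCochain ρ n →ₗ[ℂ] BddCochain ρ (n + 1) where
  toFun f := ⟨coboundaryFun G V n f.1, coboundaryFun_mem ρ n f.1 f.2⟩
  map_add' f f' := Subtype.ext ((coboundaryFun G V n).map_add f.1 f'.1)
  map_smul' c f := Subtype.ext ((coboundaryFun G V n).map_smul c f.1)

theorem coboundary_apply (ρ : IsomRep G V) (n : ℕ) (f : BddCochain ρ n) (x : Fin (n + 2) → G) :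
    (coboundary ρ n f).1 x =
      ∑ i : Fin (n + 2), (-1 : ℂ) ^ (i : ℕ) • f.1 (fun j => x (i.succAbove j)) := rfl

theorem coboundary_coboundary (ρ : IsomRep G V) (n : ℕ) (f : BddCochain ρ n) :
    coboundary ρ (n + 1) (coboundary ρ n f) = 0 := by
  refine BddCochain.ext fun x => ?_
  simp only [coboundary_apply, Finset.smul_sum, smul_smul, BddCochain.zero_val]
  let P := Fin (n + 3) × Fin (n + 2)
  let S : Finset P := {ij : P | (ij.1 : ℕ) ≤ (ij.2 : ℕ)}
  rw [← Finset.sum_product', Finset.univ_product_univ, ← Finset.sum_add_sum_compl S,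
    ← eq_neg_iff_add_eq_zero, ← Finset.sum_neg_distrib]
  let φ : ∀ ij : P, ij ∈ S → P := fun ij hij =>
    (ij.2.succ, Fin.castLT ij.1 (lt_of_le_of_lt (Finset.mem_filter.mp hij).right (Fin.is_lt ij.2)))
  apply Finset.sum_bij φ
  · intro ij hij
    simp_rw [S, φ, Finset.compl_filter, Finset.mem_filter_univ, Fin.val_succ,
      Fin.val_castLT] at hij ⊢
    lia
  · rintro ⟨i, j⟩ hij ⟨i', j'⟩ hij' h
    obtain ⟨h1, h2⟩ := Prod.mk.inj h
    have h2' : (i : ℕ) = i' := congrArg (fun z : Fin (n + 2) => (z : ℕ)) h2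
    exact Prod.ext (Fin.ext h2') (Fin.succ_inj.mp h1)
  · rintro ⟨i', j'⟩ hij'
    simp_rw [S, Finset.compl_filter, Finset.mem_filter_univ, not_le] at hij'
    refine ⟨(Fin.castSucc j', i'.pred ?_), ?_, ?_⟩
    · rintro rfl
      simp at hij'
    · simpa [S] using Nat.le_sub_one_of_lt hij'
    · simp only [φ, Fin.castLT_castSucc, Fin.succ_pred]
  · rintro ⟨i, j⟩ hij
    have hij' : (i : ℕ) ≤ (j : ℕ) := (Finset.mem_filter.mp hij).right
    simp only [φ, Fin.val_succ, Fin.val_castLT, ← neg_smul]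
    congr 1
    · ring
    · refine congrArg f.1 (funext fun k => congrArg x ?_)
      ext
      simp only [Fin.succAbove, Fin.lt_def, Fin.val_castSucc, Fin.val_succ, Fin.val_castLT]
      split_ifs <;> simp_all <;> lia

/-- Bounded `n`-cocycles. -/
def bddCocycles (ρ : IsomRep G V) (n : ℕ) : Submodule ℂ (BddCochain ρ n) :=
  LinearMap.ker (coboundary ρ n)

/-- Bounded `n`-coboundaries: coboundaries of bounded cochains. -/
def bddCoboundaries (ρ : IsomRep G V) : (n : ℕ) → Submodule ℂ (BddCochain ρ n)
  | 0 => ⊥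
  | n + 1 => LinearMap.range (coboundary ρ n)

theorem bddCoboundaries_le (ρ : IsomRep G V) (n : ℕ) : bddCoboundaries ρ n ≤ bddCocycles ρ n := by
  cases n with
  | zero => exact bot_le
  | succ n =>
    rintro _ ⟨f, rfl⟩
    exact coboundary_coboundary ρ n f

/-- Bounded cohomology `H_b^n(G; V)`: bounded cocycles modulo bounded coboundaries. -/
abbrev BddCohomology (ρ : IsomRep G V) (n : ℕ) : Type _ :=
  bddCocycles ρ n ⧸ (bddCoboundaries ρ n).submoduleOf (bddCocycles ρ n)

/-- The map in bounded cohomology induced by a map of bounded cochain complexes. -/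
def inducedMap {G' : Type*} [Group G'] (ρ : IsomRep G V) (σ : IsomRep G' W)
    (φ : ∀ n, BddCochain ρ n →ₗ[ℂ] BddCochain σ n)
    (hφ : ∀ n f, φ (n + 1) (coboundary ρ n f) = coboundary σ n (φ n f)) (n : ℕ) :
    BddCohomology ρ n →ₗ[ℂ] BddCohomology σ n :=
  Submodule.mapQ _ _
    ((φ n).restrict (p := bddCocycles ρ n) (q := bddCocycles σ n) fun f hf => by
      have hf' : coboundary ρ n f = 0 := hf
      change coboundary σ n (φ n f) = 0
      rw [← hφ, hf', map_zero])
    (by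
      rintro ⟨f, hf⟩ hfb
      change f ∈ bddCoboundaries ρ n at hfb
      change φ n f ∈ bddCoboundaries σ n
      cases n with
      | zero =>
        have h0 : f = 0 := hfb
        rw [h0, map_zero]
        exact Submodule.zero_mem _
      | succ n =>
        obtain ⟨b, rfl⟩ := hfb
        exact ⟨φ n b, (hφ n b).symm⟩)

/-- Postcomposition of cochains with a bounded `G`-equivariant map of coefficients. -/
def coeffCochainMap (ρ : IsomRep G V) (σ : IsomRep G W) (T : V →L[ℂ] W)
    (hT : ∀ g v, T (ρ g v) = σ g (T v)) (n : ℕ) : BddCochain ρ n →ₗ[ℂ] BddCochain σ n where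
  toFun f := ⟨fun x => T (f.1 x), by
    obtain ⟨⟨C, hC⟩, he⟩ := f.2
    refine ⟨⟨‖T‖ * C, fun x => ?_⟩, fun g x => ?_⟩
    · exact (T.le_opNorm _).trans (mul_le_mul_of_nonneg_left (hC x) (norm_nonneg T))
    · simp only [he, hT]⟩
  map_add' f₁ f₂ := BddCochain.ext fun x => T.map_add _ _
  map_smul' c f := BddCochain.ext fun x => T.map_smul _ _

theorem coeffCochainMap_val (ρ : IsomRep G V) (σ : IsomRep G W) (T : V →L[ℂ] W)
    (hT : ∀ g v, T (ρ g v) = σ g (T v)) (n : ℕ) (f : BddCochain ρ n) (x : Fin (n + 1) → G) :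
    (coeffCochainMap ρ σ T hT n f).1 x = T (f.1 x) := rfl

/-- Functoriality of bounded cohomology in the coefficients. -/
def coeffMap (ρ : IsomRep G V) (σ : IsomRep G W) (T : V →L[ℂ] W)
    (hT : ∀ g v, T (ρ g v) = σ g (T v)) (n : ℕ) : BddCohomology ρ n →ₗ[ℂ] BddCohomology σ n :=
  inducedMap ρ σ (coeffCochainMap ρ σ T hT)
    (fun n f => BddCochain.ext fun x => by
      rw [coboundary_apply, coeffCochainMap_val, coboundary_apply, map_sum]
      exact Finset.sum_congr rfl fun i _ => T.map_smul _ _) n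

end BoundedCohomology

/-! ### Finitely supported functions with the `ℓ¹`-norm -/

/-- The space `ℂS` of finitely supported functions `S → ℂ`, with the `ℓ¹`-norm. -/
def FinL1 (S : Type*) := S →₀ ℂ

namespace FinL1

variable {S : Type*}

instance : AddCommGroup (FinL1 S) := inferInstanceAs (AddCommGroup (S →₀ ℂ))
instance : Module ℂ (FinL1 S) := inferInstanceAs (Module ℂ (S →₀ ℂ))

/-- A finitely supported function, seen in `ℂS`. -/
def of : (S →₀ ℂ) ≃ₗ[ℂ] FinL1 S := LinearEquiv.refl ℂ _

/-- The underlying finitely supported function. -/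
abbrev fn (f : FinL1 S) : S →₀ ℂ := of.symm f

/-- The basis vector of `ℂS` given by a point of `S`. -/
def single (s : S) : FinL1 S := of (Finsupp.single s 1)

instance : Norm (FinL1 S) := ⟨fun f => f.fn.sum fun _ c => ‖c‖⟩

theorem norm_def (f : FinL1 S) : ‖f‖ = f.fn.sum fun _ c => ‖c‖ := rfl

theorem norm_eq_sum (f : FinL1 S) {t : Finset S} (ht : f.fn.support ⊆ t) :
    ‖f‖ = ∑ s ∈ t, ‖f.fn s‖ :=
  Finsupp.sum_of_support_subset _ ht _ (by simp)

theorem core : NormedSpace.Core ℂ (FinL1 S) where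
  norm_nonneg f := Finset.sum_nonneg fun _ _ => norm_nonneg _
  norm_smul c f := by
    rw [norm_eq_sum (c • f) (t := f.fn.support)
      (by rw [fn, map_smul]; exact Finsupp.support_smul), norm_def, Finsupp.sum, Finset.mul_sum]
    exact Finset.sum_congr rfl fun s _ => by simp [fn]
  norm_triangle f g := by
    classical
    rw [norm_eq_sum (f + g) (t := f.fn.support ∪ g.fn.support)
        (by rw [fn, map_add]; exact Finsupp.support_add),
      norm_eq_sum f (t := f.fn.support ∪ g.fn.support) Finset.subset_union_left,
      norm_eq_sum g (t := f.fn.support ∪ g.fn.support) Finset.subset_union_right,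
      ← Finset.sum_add_distrib]
    exact Finset.sum_le_sum fun s _ => by simpa [fn] using norm_add_le _ _
  norm_eq_zero_iff f := by
    constructor
    · intro h
      rw [norm_def, Finsupp.sum, Finset.sum_eq_zero_iff_of_nonneg fun _ _ => norm_nonneg _] at h
      refine of.symm.injective (Finsupp.ext fun s => ?_)
      rw [map_zero, Finsupp.zero_apply]
      by_contra hs
      exact hs (norm_eq_zero.mp (h s (Finsupp.mem_support_iff.mpr hs)))
    · rintro rfl
      simp [norm_def, fn]

instance : NormedAddCommGroup (FinL1 S) := NormedAddCommGroup.ofCore core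
instance : NormedSpace ℂ (FinL1 S) := NormedSpace.ofCore core

/-- The augmentation `ε(f) = ∑ s, f(s)`. -/
def augmentation (S : Type*) : FinL1 S →ₗ[ℂ] ℂ :=
  (Finsupp.linearCombination ℂ (fun _ : S => (1 : ℂ))) ∘ₗ (of (S := S)).symm.toLinearMap

theorem augmentation_apply (f : FinL1 S) : augmentation S f = f.fn.sum fun _ c => c := by
  simp [augmentation, Finsupp.linearCombination_apply]

/-- `Δ`, the kernel of the augmentation, with the restricted norm. -/
abbrev Delta (S : Type*) : Submodule ℂ (FinL1 S) := LinearMap.ker (augmentation S)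

/-- The bounded linear map `f ↦ ∑ s, f(s) v(s)` from `ℂS`, for a bounded function `v` on `S`. -/
def lift {V : Type*} [NormedAddCommGroup V] [NormedSpace ℂ V] (v : S → V) (C : ℝ)
    (hv : ∀ s, ‖v s‖ ≤ C) : FinL1 S →L[ℂ] V :=
  LinearMap.mkContinuous ((Finsupp.linearCombination ℂ v) ∘ₗ (of (S := S)).symm.toLinearMap) C
    (fun f => by
      change ‖Finsupp.linearCombination ℂ v f.fn‖ ≤ _
      rw [Finsupp.linearCombination_apply, norm_def, Finsupp.sum, Finsupp.sum, Finset.mul_sum]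
      refine (norm_sum_le _ _).trans (Finset.sum_le_sum fun s _ => ?_)
      rw [norm_smul, mul_comm]
      exact mul_le_mul_of_nonneg_right (hv s) (norm_nonneg _))

theorem lift_apply {V : Type*} [NormedAddCommGroup V] [NormedSpace ℂ V] (v : S → V) (C : ℝ)
    (hv : ∀ s, ‖v s‖ ≤ C) (f : FinL1 S) : lift v C hv f = f.fn.sum fun s c => c • v s := by
  change Finsupp.linearCombination ℂ v f.fn = _
  rw [Finsupp.linearCombination_apply]

theorem lift_single {V : Type*} [NormedAddCommGroup V] [NormedSpace ℂ V] (v : S → V) (C : ℝ)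
    (hv : ∀ s, ‖v s‖ ≤ C) (s : S) : lift v C hv (single s) = v s := by
  rw [lift_apply, single, fn, LinearEquiv.symm_apply_apply, Finsupp.sum_single_index] <;> simp

theorem norm_lift_le {V : Type*} [NormedAddCommGroup V] [NormedSpace ℂ V] (v : S → V) (C : ℝ)
    (hv : ∀ s, ‖v s‖ ≤ C) : ‖lift v C hv‖ ≤ max C 0 :=
  LinearMap.mkContinuous_norm_le' _ _

theorem hom_ext {V : Type*} [NormedAddCommGroup V] [NormedSpace ℂ V] {T T' : FinL1 S →L[ℂ] V}
    (h : ∀ s, T (single s) = T' (single s)) : T = T' := by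
  have h' : (T.toLinearMap ∘ₗ of.toLinearMap : (S →₀ ℂ) →ₗ[ℂ] V)
      = T'.toLinearMap ∘ₗ of.toLinearMap := by
    refine Finsupp.lhom_ext fun s c => ?_
    have hc : (Finsupp.single s c : S →₀ ℂ) = c • Finsupp.single s 1 := by simp
    rw [hc, map_smul, map_smul]
    exact congrArg (c • ·) (h s)
  ext f
  exact LinearMap.congr_fun h' f.fn

variable {G : Type*} [Group G] [MulAction G S]

/-- The action of a group element on `ℂS` by permuting the basis `S`. -/
def permFun (g : G) : FinL1 S ≃ₗᵢ[ℂ] FinL1 S where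
  toLinearEquiv := (of.symm.trans (Finsupp.domLCongr (MulAction.toPerm g))).trans of
  norm_map' f := by
    change (Finsupp.equivMapDomain (MulAction.toPerm g) f.fn).sum (fun _ c => ‖c‖) = _
    rw [Finsupp.sum_equivMapDomain]
    rfl

theorem permFun_apply (g : G) (f : FinL1 S) (s : S) : (permFun g f).fn s = f.fn (g⁻¹ • s) := rfl

/-- The isometric permutation action of `G` on `ℂS`: `(g • f)(s) = f(g⁻¹ • s)`. -/
def perm : IsomRep G (FinL1 S) where
  toFun := permFun
  map_one' := by
    ext1 f
    refine of.symm.injective (Finsupp.ext fun s => ?_)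
    change (permFun (1 : G) f).fn s = f.fn s
    rw [permFun_apply, inv_one, one_smul]
  map_mul' g h := by
    ext1 f
    refine of.symm.injective (Finsupp.ext fun s => ?_)
    change (permFun (g * h) f).fn s = (permFun g (permFun h f)).fn s
    rw [permFun_apply, permFun_apply, permFun_apply, mul_inv_rev, mul_smul]

theorem perm_apply (g : G) (f : FinL1 S) (s : S) : (perm g f).fn s = f.fn (g⁻¹ • s) := rfl

theorem perm_single (g : G) (s : S) : perm g (single s) = single (g • s) :=
  of.symm.injective (Finsupp.equivMapDomain_single _ _ _)

theorem augmentation_perm (g : G) (f : FinL1 S) :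
    augmentation S (perm g f) = augmentation S f := by
  rw [augmentation_apply, augmentation_apply]
  change (Finsupp.equivMapDomain (MulAction.toPerm g) f.fn).sum (fun _ c => c) = _
  rw [Finsupp.sum_equivMapDomain]

/-- The isometric action of `G` on `Δ`, the restriction of the one on `ℂS`. -/
def permDelta : IsomRep G (Delta S) where
  toFun g :=
    { toLinearEquiv := (perm g : FinL1 S ≃ₗᵢ[ℂ] FinL1 S).toLinearEquiv.ofSubmodules
        (Delta S) (Delta S) (by
          ext f
          constructor
          · rintro ⟨f, hf, rfl⟩
            exact (augmentation_perm g f).trans hf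
          · intro hf
            exact ⟨perm g⁻¹ f, (augmentation_perm g⁻¹ f).trans hf,
              IsomRep.self_apply_inv perm g f⟩)
      norm_map' := fun f => (perm g : FinL1 S ≃ₗᵢ[ℂ] FinL1 S).norm_map f.1 }
  map_one' := by ext1 f; exact Subtype.ext (IsomRep.one_apply perm f.1)
  map_mul' g h := by ext1 f; exact Subtype.ext (IsomRep.mul_apply perm g h f.1)

theorem permDelta_coe (g : G) (f : Delta S) : (permDelta g f : FinL1 S) = perm g f.1 := rfl

end FinL1

/-! ### Cohomology of a family of subgroups and relative cohomology -/

section Relative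

variable {G ι V : Type*} [Group G] [NormedAddCommGroup V] [NormedSpace ℂ V]

/-- `G/𝓗`, the disjoint union of the left coset spaces `G/H i`, with left translation by `G`. -/
abbrev CosetUnion (H : ι → Subgroup G) := Σ i, G ⧸ H i

/-- `H_b^n(𝓗; V)`, the product of the bounded cohomologies `H_b^n(H i; V)`. -/
abbrev FamilyBddCohomology (H : ι → Subgroup G) (ρ : IsomRep G V) (n : ℕ) : Type _ :=
  ∀ i, BddCohomology (ρ.res (H i)) n

/-- Relative bounded cohomology `H_b^(n+1)(G, 𝓗; V) = H_b^n(G; bHom(Δ, V))`, where `Δ` is the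
kernel of the augmentation of `ℂ[G/𝓗]`. -/
abbrev RelBddCohomologySucc (H : ι → Subgroup G) (ρ : IsomRep G V) (n : ℕ) : Type _ :=
  BddCohomology (IsomRep.bHom (FinL1.permDelta (S := CosetUnion H)) ρ) n

/-- A map `r : G → H` with `r (h * g) = h * r g` and `r h = h` for `h ∈ H`. -/
def cosetRetraction (H : Subgroup G) (g : G) : H :=
  ⟨g * (Quotient.out ((g⁻¹ : G) : G ⧸ H)) * (Quotient.out ((1 : G) : G ⧸ H))⁻¹, by
    have h1 : (g⁻¹)⁻¹ * Quotient.out ((g⁻¹ : G) : G ⧸ H) ∈ H :=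
      QuotientGroup.eq.mp (QuotientGroup.out_eq' ((g⁻¹ : G) : G ⧸ H)).symm
    have h2 : (1 : G)⁻¹ * Quotient.out ((1 : G) : G ⧸ H) ∈ H :=
      QuotientGroup.eq.mp (QuotientGroup.out_eq' ((1 : G) : G ⧸ H)).symm
    rw [inv_inv] at h1
    rw [inv_one, one_mul] at h2
    exact H.mul_mem h1 (H.inv_mem h2)⟩

theorem cosetRetraction_mul (H : Subgroup G) (h : H) (g : G) :
    cosetRetraction H (h * g) = h * cosetRetraction H g := by
  have e : ((((h : G) * g)⁻¹ : G) : G ⧸ H) = ((g⁻¹ : G) : G ⧸ H) := by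
    rw [mul_inv_rev, QuotientGroup.eq]
    simp
  apply Subtype.ext
  change ((h : G) * g) * Quotient.out ((((h : G) * g)⁻¹ : G) : G ⧸ H) * _ = (h : G) * (g * _ * _)
  rw [e]
  group

theorem cosetRetraction_self (H : Subgroup G) (h : H) : cosetRetraction H h = h := by
  have e : cosetRetraction H 1 = 1 := by
    apply Subtype.ext
    change (1 : G) * Quotient.out (((1 : G)⁻¹ : G) : G ⧸ H) * _ = 1
    rw [inv_one, one_mul, mul_inv_cancel]
  have := cosetRetraction_mul H h 1
  rwa [mul_one, e, mul_one] at this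

/-- For a bounded cochain `c` of a subgroup `H`, the value `a • c (r (a⁻¹ x₀), …, r (a⁻¹ xₙ))`;
it depends only on the coset `aH`. -/
def shapiroVal (H : Subgroup G) (ρ : IsomRep G V) {n : ℕ} (c : BddCochain (ρ.res H) n)
    (x : Fin (n + 1) → G) (a : G) : V :=
  ρ a (c.1 fun j => cosetRetraction H (a⁻¹ * x j))

theorem shapiroVal_congr (H : Subgroup G) (ρ : IsomRep G V) {n : ℕ} (c : BddCochain (ρ.res H) n)
    (x : Fin (n + 1) → G) {a b : G} (hab : (a : G ⧸ H) = b) :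
    shapiroVal H ρ c x a = shapiroVal H ρ c x b := by
  have hm : a⁻¹ * b ∈ H := QuotientGroup.eq.mp hab
  have hk : ∀ j, cosetRetraction H (a⁻¹ * x j)
      = (⟨a⁻¹ * b, hm⟩ : H) * cosetRetraction H (b⁻¹ * x j) := fun j => by
    rw [← cosetRetraction_mul]
    congr 1
    simp [mul_assoc]
  unfold shapiroVal
  simp only [hk]
  rw [c.2.2]
  change ρ a (ρ (a⁻¹ * b) _) = _
  rw [← IsomRep.mul_apply, mul_inv_cancel_left]

/-- The function on `G/𝓗` underlying the cochain map below. -/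
def shapiroFun (H : ι → Subgroup G) (ρ : IsomRep G V) {n : ℕ}
    (c : ∀ i, BddCochain (ρ.res (H i)) n) (x : Fin (n + 1) → G) (s : CosetUnion H) : V :=
  shapiroVal (H s.1) ρ (c s.1) x s.2.out

theorem shapiroFun_mk (H : ι → Subgroup G) (ρ : IsomRep G V) {n : ℕ}
    (c : ∀ i, BddCochain (ρ.res (H i)) n) (x : Fin (n + 1) → G) (i : ι) (a : G) :
    shapiroFun H ρ c x ⟨i, (a : G ⧸ H i)⟩
      = ρ a ((c i).1 fun j => cosetRetraction (H i) (a⁻¹ * x j)) :=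
  shapiroVal_congr (H i) ρ (c i) x (QuotientGroup.out_eq' _)

theorem shapiroFun_smul (H : ι → Subgroup G) (ρ : IsomRep G V) {n : ℕ}
    (c : ∀ i, BddCochain (ρ.res (H i)) n) (x : Fin (n + 1) → G) (g : G) (s : CosetUnion H) :
    shapiroFun H ρ c (fun j => g * x j) s = ρ g (shapiroFun H ρ c x (g⁻¹ • s)) := by
  obtain ⟨i, y⟩ := s
  obtain ⟨a, rfl⟩ := QuotientGroup.mk_surjective y
  have e : g⁻¹ • (⟨i, (a : G ⧸ H i)⟩ : CosetUnion H) = ⟨i, ((g⁻¹ * a : G) : G ⧸ H i)⟩ := rfl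
  rw [e, shapiroFun_mk, shapiroFun_mk, ← IsomRep.mul_apply, mul_inv_cancel_left]
  simp [mul_assoc]

theorem coboundary_single [DecidableEq ι] (H : ι → Subgroup G) (ρ : IsomRep G V) (m : ℕ) (i : ι)
    (f : BddCochain (ρ.res (H i)) m) :
    Pi.single i (coboundary _ m f) = fun j => coboundary (ρ.res (H j)) m
      ((Pi.single i f : ∀ j, BddCochain (ρ.res (H j)) m) j) := by
  funext j
  by_cases hj : j = i
  · subst hj
    rw [Pi.single_eq_same, Pi.single_eq_same]
  · rw [Pi.single_eq_of_ne hj, Pi.single_eq_of_ne hj, map_zero]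

variable [Fintype ι]

theorem exists_shapiroFun_bound (H : ι → Subgroup G) (ρ : IsomRep G V) {n : ℕ}
    (c : ∀ i, BddCochain (ρ.res (H i)) n) : ∃ C : ℝ, ∀ x s, ‖shapiroFun H ρ c x s‖ ≤ C := by
  choose C hC using fun i => (c i).2.1
  refine ⟨∑ i, C i, fun x s => ?_⟩
  have h0 : ∀ i, 0 ≤ C i := fun i => (norm_nonneg _).trans (hC i 1)
  unfold shapiroFun shapiroVal
  rw [LinearIsometryEquiv.norm_map]
  exact (hC _ _).trans (Finset.single_le_sum (fun i _ => h0 i) (Finset.mem_univ s.1))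

/-- The bounded linear map on `ℂ[G/𝓗]` given on basis vectors by `shapiroFun`. -/
def shapiroHom (H : ι → Subgroup G) (ρ : IsomRep G V) {n : ℕ}
    (c : ∀ i, BddCochain (ρ.res (H i)) n) (x : Fin (n + 1) → G) :
    FinL1 (CosetUnion H) →L[ℂ] V :=
  FinL1.lift (shapiroFun H ρ c x) (exists_shapiroFun_bound H ρ c).choose
    ((exists_shapiroFun_bound H ρ c).choose_spec x)

theorem shapiroHom_single (H : ι → Subgroup G) (ρ : IsomRep G V) {n : ℕ}
    (c : ∀ i, BddCochain (ρ.res (H i)) n) (x : Fin (n + 1) → G) (s : CosetUnion H) :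
    shapiroHom H ρ c x (FinL1.single s) = shapiroFun H ρ c x s :=
  FinL1.lift_single _ _ _ _

/-- The cochain map `∏ i, C_b^n(H i; V) → C_b^n(G; bHom(ℂ[G/𝓗], V))` realising the Eckmann-Shapiro
isomorphism: `c` goes to the cochain whose value at `(x₀, …, xₙ)` is the map sending the basis
vector `a (H i)` to `a • c i (r (a⁻¹ x₀), …, r (a⁻¹ xₙ))`. -/
def shapiroCochainMap (H : ι → Subgroup G) (ρ : IsomRep G V) (n : ℕ) :
    (∀ i, BddCochain (ρ.res (H i)) n) →ₗ[ℂ]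
      BddCochain (IsomRep.bHom (FinL1.perm (S := CosetUnion H)) ρ) n where
  toFun c := ⟨fun x => shapiroHom H ρ c x, by
    constructor
    · exact ⟨max (exists_shapiroFun_bound H ρ c).choose 0,
        fun x => FinL1.norm_lift_le _ _ _⟩
    · intro g x
      refine FinL1.hom_ext fun s => ?_
      rw [shapiroHom_single, IsomRep.bHom_apply, FinL1.perm_single, shapiroHom_single,
        shapiroFun_smul]⟩
  map_add' c c' := BddCochain.ext fun x => FinL1.hom_ext fun s => by
    change shapiroHom H ρ (c + c') x (FinL1.single s)
      = shapiroHom H ρ c x (FinL1.single s) + shapiroHom H ρ c' x (FinL1.single s)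
    simp [shapiroHom_single, shapiroFun, shapiroVal, BddCochain.add_val]
  map_smul' t c := BddCochain.ext fun x => FinL1.hom_ext fun s => by
    change shapiroHom H ρ (t • c) x (FinL1.single s) = t • shapiroHom H ρ c x (FinL1.single s)
    simp [shapiroHom_single, shapiroFun, shapiroVal, BddCochain.smul_val]

theorem shapiroCochainMap_single (H : ι → Subgroup G) (ρ : IsomRep G V) {n : ℕ}
    (c : ∀ i, BddCochain (ρ.res (H i)) n) (x : Fin (n + 1) → G) (s : CosetUnion H) :
    (shapiroCochainMap H ρ n c).1 x (FinL1.single s) = shapiroFun H ρ c x s :=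
  shapiroHom_single H ρ c x s

theorem shapiroCochainMap_coboundary (H : ι → Subgroup G) (ρ : IsomRep G V) (n : ℕ)
    (c : ∀ i, BddCochain (ρ.res (H i)) n) :
    shapiroCochainMap H ρ (n + 1) (fun i => coboundary _ n (c i))
      = coboundary _ n (shapiroCochainMap H ρ n c) := by
  refine BddCochain.ext fun x => FinL1.hom_ext fun s => ?_
  rw [shapiroCochainMap_single, coboundary_apply, sum_apply]
  simp only [smul_apply, shapiroCochainMap_single]
  simp [shapiroFun, shapiroVal, coboundary_apply]

/-- Restricting to `H i` and evaluating at the base coset `H i`, which is the usual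
Eckmann-Shapiro map in the other direction, is a left inverse of `shapiroCochainMap`. -/
theorem shapiroCochainMap_restrict (H : ι → Subgroup G) (ρ : IsomRep G V) {n : ℕ}
    (c : ∀ i, BddCochain (ρ.res (H i)) n) (i : ι) (x : Fin (n + 1) → H i) :
    (shapiroCochainMap H ρ n c).1 (fun j => x j) (FinL1.single ⟨i, ((1 : G) : G ⧸ H i)⟩)
      = (c i).1 x := by
  rw [shapiroCochainMap_single, shapiroFun_mk, IsomRep.one_apply]
  simp [cosetRetraction_self]

open Classical in
/-- The Eckmann-Shapiro isomorphism `∏ i, H_b^n(H i; V) → H_b^n(G; bHom(ℂ[G/𝓗], V))`, the sum of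
the maps induced on the factors. -/
def shapiroMap (H : ι → Subgroup G) (ρ : IsomRep G V) (n : ℕ) :
    FamilyBddCohomology H ρ n →ₗ[ℂ]
      BddCohomology (IsomRep.bHom (FinL1.perm (S := CosetUnion H)) ρ) n :=
  ∑ i, (inducedMap (ρ.res (H i)) (IsomRep.bHom (FinL1.perm (S := CosetUnion H)) ρ)
      (fun m => shapiroCochainMap H ρ m ∘ₗ
        LinearMap.single ℂ (fun j => BddCochain (ρ.res (H j)) m) i)
      (fun m f => by
        rw [LinearMap.comp_apply, LinearMap.comp_apply, ← shapiroCochainMap_coboundary]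
        exact congrArg _ (coboundary_single H ρ m i f)) n) ∘ₗ LinearMap.proj i

/-- The map `H_b^n(𝓗; V) → H_b^(n+1)(G, 𝓗; V)` of the long exact sequence of the pair: the
Eckmann-Shapiro isomorphism followed by the map induced by restricting bounded linear maps from
`ℂ[G/𝓗]` to `Δ`. -/
def connectingMap (H : ι → Subgroup G) (ρ : IsomRep G V) (n : ℕ) :
    FamilyBddCohomology H ρ n →ₗ[ℂ] RelBddCohomologySucc H ρ n :=
  coeffMap (IsomRep.bHom (FinL1.perm (S := CosetUnion H)) ρ)
      (IsomRep.bHom (FinL1.permDelta (S := CosetUnion H)) ρ)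
      (ContinuousLinearMap.precomp V (FinL1.Delta (CosetUnion H)).subtypeL)
      (fun _ _ => rfl) n
    ∘ₗ shapiroMap H ρ n

end Relative

/-! ### Relative amenability -/

section Amenability

variable {G X K ι : Type*} [Group G] [TopologicalSpace X] [MulAction G X]
  [ContinuousConstSMul G X] [MulAction G K]

/-- The `V`-norm `sup_x ∑_k |f_k(x)|` of a function `f : K → C(X)`, as an extended real. -/
def VNorm (f : K → C(X, ℝ)) : ℝ≥0∞ := ⨆ x, ∑' k, ‖f k x‖ₑ

/-- The translate `(g • f)_k(x) = f_{g⁻¹k}(g⁻¹x)` of a function `f : K → C(X)`. -/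
def VTranslate (g : G) (f : K → C(X, ℝ)) : K → C(X, ℝ) := fun k =>
  (f (g⁻¹ • k)).comp ⟨fun x => g⁻¹ • x, continuous_const_smul g⁻¹⟩

/-- `K` is a countable cofinite `G`-set whose point stabilizers are precisely the conjugates of
the members of `H`. -/
def IsAdaptedSet (H : ι → Subgroup G) (K : Type*) [MulAction G K] : Prop :=
  Countable K ∧ Finite (MulAction.orbitRel.Quotient G K) ∧
    Set.range (MulAction.stabilizer G (α := K))
      = {L | ∃ i, ∃ g : G, L = (H i).map (MulAut.conj g).toMonoidHom}

variable (X) in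
/-- The action of `G` on the (compact Hausdorff) space `X` is amenable relative to `H`: for some adapted `K` there are finitely
supported `fⁿ : K → C(X)` with `fⁿ ≥ 0`, `∑ₖ fⁿₖ = 1` and `‖fⁿ - g fⁿ‖_V → 0` for every `g`. -/
def IsRelAmenableAction (H : ι → Subgroup G) : Prop :=
  ∃ (K : Type) (_ : MulAction G K), IsAdaptedSet H K ∧
    ∃ f : ℕ → K → C(X, ℝ),
      (∀ n, (Function.support (f n)).Finite) ∧
      (∀ n k x, 0 ≤ f n k x) ∧
      (∀ n x, ∑ᶠ k, f n k x = 1) ∧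
      ∀ g : G, Tendsto (fun n => VNorm (f n - VTranslate g (f n))) atTop (𝓝 0)

/-- `G` is relatively amenable with respect to `H`: it acts amenably relative to `H` on a point. -/
def IsRelAmenable (H : ι → Subgroup G) : Prop :=
  IsRelAmenableAction PUnit.{1} H

end Amenability

end

/-! The Eckmann-Shapiro map is onto in cohomology for every `H`, so everything rests on the
restriction `bHom(ℂ[G/𝓗], E*) → bHom(Δ, E*)`. Relative amenability amounts to an asymptotically
invariant sequence of norm-one, augmentation-one vectors in `ℂ[G/𝓗]`.

Such a sequence `b m` splits the restriction: `x ↦ x - ε(x) b m` projects `ℂ[G/𝓗]` onto `Δ`, and the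
weak-* limit of `φ (x - ε(x) b m)` along an ultrafilter extends `φ`. The failure of equivariance is
at most a multiple of `‖b m - g b m‖`, so the limit is equivariant (`exists_equivariant_extension`),
and an equivariant bounded section gives surjectivity in every degree. Surjectivity of the Shapiro
map (`shapiroMap_surjective`) comes from a prism homotopy: restricting a cocycle to base cosets and
inducing back only moves its vertices, by maps compatible with `G`.

Conversely, degree zero and the single module `E = Δ*` suffice. The canonical embedding `Δ → Δ**` is
an invariant 0-cocycle, and surjectivity extends it to an equivariant map `A` on `ℂ[G/𝓗]`
(`exists_extension_of_connectingMap_surjective`). With `v k = A δ_k`, the element `δ_k - v k` of the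
bidual of `ℂ[G/𝓗]` does not depend on `k`, hence is invariant, and it has augmentation one. A
Hahn-Banach argument in the style of Namioka replaces it by genuine almost invariant vectors
(`exists_almost_invariant`), whose normalised absolute values witness relative amenability. -/

noncomputable section

/-! ### The prism homotopy -/

section Prism

variable {X V : Type*} [NormedAddCommGroup V]

/-- The prism operator of a self-map `p` of the vertices:
`∑ i, (-1)^i f (x₀, …, xᵢ, p xᵢ, …, p xₙ₋₁)`. -/
def prism (p : X → X) : (n : ℕ) → ((Fin (n + 1) → X) → V) → (Fin n → X) → V
  | 0, _ => fun _ => 0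
  | n + 1, f => fun x => f (Fin.cons (x 0) (p ∘ x))
      - prism p n (fun y => f (Fin.cons (x 0) y)) (Fin.tail x)

theorem prism_cons (p : X → X) (n : ℕ) (f : (Fin (n + 2) → X) → V) (a : X) (y : Fin n → X) :
    prism p (n + 1) f (Fin.cons a y : Fin (n + 1) → X)
      = f (Fin.cons a (Fin.cons (p a) (p ∘ y) : Fin (n + 1) → X))
        - prism p n (fun z => f (Fin.cons a z)) y := by
  have h : p ∘ (Fin.cons a y : Fin (n + 1) → X) = Fin.cons (p a) (p ∘ y) := by
    funext j
    refine Fin.cases ?_ (fun j => ?_) j <;> simp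
  simp only [prism, h, Fin.cons_zero, Fin.tail_cons]

theorem prism_sub (p : X → X) (n : ℕ) (f f' : (Fin (n + 1) → X) → V) (x : Fin n → X) :
    prism p n (fun y => f y - f' y) x = prism p n f x - prism p n f' x := by
  induction n with
  | zero => simp [prism]
  | succ n ih =>
    simp only [prism]
    rw [ih]
    abel

theorem prism_zero (p : X → X) (n : ℕ) (x : Fin n → X) :
    prism p n (fun _ => (0 : V)) x = 0 := by
  simpa using prism_sub p n (fun _ => (0 : V)) (fun _ => 0) x

theorem norm_prism_le (p : X → X) (n : ℕ) (f : (Fin (n + 1) → X) → V) {C : ℝ}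
    (hf : ∀ x, ‖f x‖ ≤ C) (x : Fin n → X) : ‖prism p n f x‖ ≤ n * C := by
  induction n with
  | zero => simp [prism]
  | succ n ih =>
    refine (norm_sub_le _ _).trans ?_
    have h := ih (fun y => f (Fin.cons (x 0) y)) (fun y => hf _) (Fin.tail x)
    have h' := hf (Fin.cons (x 0) (p ∘ x))
    push_cast
    linarith

variable [NormedSpace ℂ V]

/-- The homogeneous coboundary on functions of `n` variables, including `n = 0`. -/
def simplexCoboundary (n : ℕ) (f : (Fin n → X) → V) (x : Fin (n + 1) → X) : V :=
  ∑ i : Fin (n + 1), (-1 : ℂ) ^ (i : ℕ) • f (fun j => x (i.succAbove j))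

theorem simplexCoboundary_sub (n : ℕ) (f f' : (Fin n → X) → V) :
    simplexCoboundary n (fun y => f y - f' y)
      = fun x => simplexCoboundary n f x - simplexCoboundary n f' x := by
  ext x
  simp [simplexCoboundary, smul_sub, Finset.sum_sub_distrib]

theorem simplexCoboundary_cons (n : ℕ) (f : (Fin (n + 1) → X) → V) (a : X) (y : Fin (n + 1) → X) :
    simplexCoboundary (n + 1) f (Fin.cons a y : Fin (n + 2) → X)
      = f y - simplexCoboundary n (fun z => f (Fin.cons a z : Fin (n + 1) → X)) y := by
  unfold simplexCoboundary
  rw [Fin.sum_univ_succ, sub_eq_add_neg, ← Finset.sum_neg_distrib]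
  congr 1
  · simp
  · refine Finset.sum_congr rfl fun i _ => ?_
    rw [Fin.val_succ, pow_succ, mul_neg_one, neg_smul]
    refine congrArg (fun z => -((-1 : ℂ) ^ (i : ℕ) • f z)) (funext fun j => ?_)
    refine Fin.cases ?_ (fun j => ?_) j
    · simp
    · simp

/-- Gives the equivariance of the prism homotopy: `τ` will be translation by `g`, `T` the action of
`g` on coefficients, and `p`, `p'` the vertex maps of the cosets `g⁻¹ • s` and `s`. -/
theorem prism_natural {p p' : X → X} (τ : X → X) (T : V →ₗ[ℂ] V)
    (hp : ∀ x, p' (τ x) = τ (p x)) (n : ℕ) (f f' : (Fin (n + 1) → X) → V)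
    (hf : ∀ x, f' (fun j => τ (x j)) = T (f x)) (x : Fin n → X) :
    prism p' n f' (fun j => τ (x j)) = T (prism p n f x) := by
  have hc : ∀ {m : ℕ} (a : X) (y : Fin m → X),
      (Fin.cons (τ a) (fun j => τ (y j)) : Fin (m + 1) → X)
        = fun j => τ ((Fin.cons a y : Fin (m + 1) → X) j) := by
    intro m a y
    funext j
    refine Fin.cases ?_ (fun j => ?_) j <;> simp
  induction n with
  | zero => simp [prism]
  | succ n ih =>
    simp only [prism, map_sub]
    congr 1
    · rw [← hf, ← hc]
      congr 2
      funext j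
      exact hp _
    · refine ih (fun y => f (Fin.cons (x 0) y)) (fun y => f' (Fin.cons (τ (x 0)) y))
        (fun y => ?_) (Fin.tail x)
      rw [hc, hf]

/-- The identity `dP + Pd = p* - id`, by induction on the first vertex `a`. With `f_a = f (a, ·)`,
both operators reduce to themselves on `f_a`, up to sign, plus one explicit term. The terms `P f`
cancel, and the explicit ones leave `f (p a, p y) - f (a, p y)`, which telescopes with the inductive
hypothesis for `f_a`. Counting variables from zero makes degree zero an instance of the same
formula. -/
theorem prism_homotopy (p : X → X) (n : ℕ) (f : (Fin (n + 1) → X) → V) (x : Fin (n + 1) → X) :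
    simplexCoboundary n (prism p n f) x + prism p (n + 1) (simplexCoboundary (n + 1) f) x
      = f (p ∘ x) - f x := by
  induction n with
  | zero =>
    have h1 : simplexCoboundary 0 (prism p 0 f) x = 0 := by simp [simplexCoboundary, prism]
    rw [h1, zero_add]
    simp only [prism, simplexCoboundary_cons, sub_zero]
    congr 1
    rw [simplexCoboundary, Fin.sum_univ_one, Fin.val_zero, pow_zero, one_smul]
    congr 1
    funext j
    obtain rfl : j = 0 := Fin.fin_one_eq_zero j
    rw [Fin.cons_zero]
  | succ n ih =>
    obtain ⟨a, y, rfl⟩ : ∃ a y, x = (Fin.cons a y : Fin (n + 2) → X) :=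
      ⟨x 0, Fin.tail x, (Fin.cons_self_tail x).symm⟩
    have hp : p ∘ (Fin.cons a y : Fin (n + 2) → X) = Fin.cons (p a) (p ∘ y) := by
      funext j
      refine Fin.cases ?_ (fun j => ?_) j <;> simp
    have h := ih (fun z => f (Fin.cons a z)) y
    have e1 : (fun z => simplexCoboundary (n + 1 + 1) f (Fin.cons a z : Fin (n + 3) → X))
        = fun z => f z - simplexCoboundary (n + 1) (fun z => f (Fin.cons a z)) z :=
      funext fun z => simplexCoboundary_cons (n + 1) f a z
    have e2 : (fun z => prism p (n + 1) f (Fin.cons a z : Fin (n + 1) → X))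
        = fun z => f (Fin.cons a (Fin.cons (p a) (p ∘ z) : Fin (n + 1) → X))
          - prism p n (fun z => f (Fin.cons a z)) z :=
      funext fun z => prism_cons p n f a z
    rw [simplexCoboundary_cons, prism_cons, simplexCoboundary_cons, e1, prism_sub, e2,
      simplexCoboundary_sub, simplexCoboundary_cons, hp]
    -- Deleting a vertex commutes with applying `p` to all vertices, so these two terms cancel.
    have e3 : simplexCoboundary n
        (fun z => f (Fin.cons a (Fin.cons (p a) z : Fin (n + 1) → X))) (p ∘ y)
        = simplexCoboundary n
          (fun z => f (Fin.cons a (Fin.cons (p a) (p ∘ z) : Fin (n + 1) → X))) y := rfl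
    rw [e3]
    have h' := sub_eq_zero.mpr h
    rw [← sub_eq_zero]
    rw [← h']
    beta_reduce
    abel

end Prism

/-! ### Surjectivity of the Eckmann-Shapiro map -/

theorem FinL1.norm_single {S : Type*} (s : S) : ‖FinL1.single s‖ = 1 := by
  rw [FinL1.norm_def]
  change (Finsupp.single s (1 : ℂ)).sum (fun _ c => ‖c‖) = 1
  rw [Finsupp.sum_single_index] <;> simp

section Shapiro

variable {G ι V : Type*} [Group G] [NormedAddCommGroup V] [NormedSpace ℂ V]

/-- For `s = a (H i)`, the point `a * r (a⁻¹ * x)` of the coset `s`. -/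
def cosetPoint (H : ι → Subgroup G) (s : CosetUnion H) (x : G) : G :=
  s.2.out * (cosetRetraction (H s.1) (s.2.out⁻¹ * x) : G)

/-- Independence of the chosen representative: changing `a` by an element of `H i` is absorbed by
the left equivariance of the retraction. -/
theorem cosetPoint_mk (H : ι → Subgroup G) (i : ι) (a x : G) :
    cosetPoint H ⟨i, (a : G ⧸ H i)⟩ x = a * (cosetRetraction (H i) (a⁻¹ * x) : G) := by
  have hm : a⁻¹ * (a : G ⧸ H i).out ∈ H i :=
    QuotientGroup.eq.mp (QuotientGroup.out_eq' (a : G ⧸ H i)).symm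
  have h := cosetRetraction_mul (H i) ⟨_, hm⟩ ((a : G ⧸ H i).out⁻¹ * x)
  have e : a⁻¹ * (a : G ⧸ H i).out * ((a : G ⧸ H i).out⁻¹ * x) = a⁻¹ * x := by group
  change cosetRetraction (H i) (a⁻¹ * (a : G ⧸ H i).out * _) = _ at h
  rw [e] at h
  rw [h, cosetPoint, Subgroup.coe_mul]
  group

/-- A single vertex map cannot be equivariant under `G`, but the family indexed by the cosets is.
This joint equivariance makes the assembled homotopy a homogeneous cochain. -/
theorem cosetPoint_smul (H : ι → Subgroup G) (g : G) (s : CosetUnion H) (x : G) :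
    cosetPoint H (g • s) (g * x) = g * cosetPoint H s x := by
  obtain ⟨i, y⟩ := s
  obtain ⟨a, rfl⟩ := QuotientGroup.mk_surjective y
  have e : g • (⟨i, (a : G ⧸ H i)⟩ : CosetUnion H) = ⟨i, ((g * a : G) : G ⧸ H i)⟩ := rfl
  rw [e, cosetPoint_mk, cosetPoint_mk]
  simp [mul_assoc]

theorem cochain_smul_single {S : Type*} [MulAction G S] {ρ : IsomRep G V} {n : ℕ}
    (F : BddCochain (IsomRep.bHom (FinL1.perm (S := S)) ρ) n) (g : G) (x : Fin (n + 1) → G)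
    (s : S) : F.1 (fun j => g * x j) (FinL1.single (g • s)) = ρ g (F.1 x (FinL1.single s)) := by
  rw [F.2.2, IsomRep.bHom_apply, FinL1.perm_single, inv_smul_smul]

/-- Restriction to `H i` followed by evaluation at the base coset. -/
def baseRestrict (H : ι → Subgroup G) (ρ : IsomRep G V) {n : ℕ}
    (F : BddCochain (IsomRep.bHom (FinL1.perm (S := CosetUnion H)) ρ) n) (i : ι) :
    BddCochain (ρ.res (H i)) n :=
  ⟨fun x => F.1 (fun j => x j) (FinL1.single ⟨i, ((1 : G) : G ⧸ H i)⟩), by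
    constructor
    · obtain ⟨C, hC⟩ := F.2.1
      refine ⟨C, fun x => ((F.1 _).le_opNorm _).trans ?_⟩
      rw [FinL1.norm_single, mul_one]
      exact hC _
    · intro h x
      have e : (h : G) • (⟨i, ((1 : G) : G ⧸ H i)⟩ : CosetUnion H) = ⟨i, ((1 : G) : G ⧸ H i)⟩ := by
        change (⟨i, (((h : G) * 1 : G) : G ⧸ H i)⟩ : CosetUnion H) = _
        congr 1
        rw [QuotientGroup.eq]
        simp
      have := cochain_smul_single F (h : G) (fun j => (x j : G)) ⟨i, ((1 : G) : G ⧸ H i)⟩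
      rw [e] at this
      exact this⟩

theorem baseRestrict_val (H : ι → Subgroup G) (ρ : IsomRep G V) {n : ℕ}
    (F : BddCochain (IsomRep.bHom (FinL1.perm (S := CosetUnion H)) ρ) n) (i : ι)
    (x : Fin (n + 1) → H i) : (baseRestrict H ρ F i).1 x
      = F.1 (fun j => x j) (FinL1.single ⟨i, ((1 : G) : G ⧸ H i)⟩) := rfl

theorem coboundary_baseRestrict (H : ι → Subgroup G) (ρ : IsomRep G V) {n : ℕ}
    (F : BddCochain (IsomRep.bHom (FinL1.perm (S := CosetUnion H)) ρ) n) (i : ι) :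
    coboundary _ n (baseRestrict H ρ F i) = baseRestrict H ρ (coboundary _ n F) i := by
  refine BddCochain.ext fun x => ?_
  rw [coboundary_apply, baseRestrict_val, coboundary_apply, sum_apply]
  rfl

/-- By equivariance of `F`, acting by `a` on the value at the base coset moves both the vertices and
the coset. So restricting and inducing back merely applies the vertex map of `s`, which is homotopic
to the identity by the prism operator. -/
theorem shapiroFun_baseRestrict (H : ι → Subgroup G) (ρ : IsomRep G V) {n : ℕ}
    (F : BddCochain (IsomRep.bHom (FinL1.perm (S := CosetUnion H)) ρ) n) (x : Fin (n + 1) → G)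
    (s : CosetUnion H) : shapiroFun H ρ (baseRestrict H ρ F) x s
      = F.1 (cosetPoint H s ∘ x) (FinL1.single s) := by
  obtain ⟨i, y⟩ := s
  obtain ⟨a, rfl⟩ := QuotientGroup.mk_surjective y
  rw [shapiroFun_mk, baseRestrict_val, ← cochain_smul_single]
  have e : a • (⟨i, ((1 : G) : G ⧸ H i)⟩ : CosetUnion H) = ⟨i, (a : G ⧸ H i)⟩ := by
    change (⟨i, ((a * 1 : G) : G ⧸ H i)⟩ : CosetUnion H) = _
    rw [mul_one]
  rw [e]
  congr 2
  refine congrArg F.1 (funext fun j => ?_)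
  exact (cosetPoint_mk H i a (x j)).symm

theorem norm_prism_eval_le (H : ι → Subgroup G) (ρ : IsomRep G V) {n : ℕ}
    (F : BddCochain (IsomRep.bHom (FinL1.perm (S := CosetUnion H)) ρ) n) (x : Fin n → G)
    (s : CosetUnion H) :
    ‖prism (cosetPoint H s) n (fun y => F.1 y (FinL1.single s)) x‖ ≤ n * F.2.1.choose :=
  norm_prism_le _ _ _ (fun y => by
    refine ((F.1 y).le_opNorm _).trans ?_
    rw [FinL1.norm_single, mul_one]
    exact F.2.1.choose_spec y) x

/-- The prism operators of the maps `cosetPoint H s`, assembled to a cochain. -/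
def shapiroHomotopy (H : ι → Subgroup G) (ρ : IsomRep G V) {n : ℕ}
    (F : BddCochain (IsomRep.bHom (FinL1.perm (S := CosetUnion H)) ρ) (n + 1)) :
    BddCochain (IsomRep.bHom (FinL1.perm (S := CosetUnion H)) ρ) n :=
  ⟨fun x => FinL1.lift
      (fun s => prism (cosetPoint H s) (n + 1) (fun y => F.1 y (FinL1.single s)) x) _
      (norm_prism_eval_le H ρ F x), by
    constructor
    · exact ⟨_, fun x => FinL1.norm_lift_le _ _ _⟩
    · intro g x
      refine FinL1.hom_ext fun s => ?_
      rw [IsomRep.bHom_apply, FinL1.perm_single, FinL1.lift_single, FinL1.lift_single]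
      refine prism_natural (fun y => g * y) ((ρ g).toLinearEquiv : V →ₗ[ℂ] V) (fun y => ?_) _ _ _
        (fun y => ?_) x
      · rw [← cosetPoint_smul, smul_inv_smul]
      · refine Eq.trans ?_ (cochain_smul_single F g y (g⁻¹ • s))
        rw [smul_inv_smul]⟩

theorem shapiroHomotopy_single (H : ι → Subgroup G) (ρ : IsomRep G V) {n : ℕ}
    (F : BddCochain (IsomRep.bHom (FinL1.perm (S := CosetUnion H)) ρ) (n + 1))
    (x : Fin (n + 1) → G) (s : CosetUnion H) :
    (shapiroHomotopy H ρ F).1 x (FinL1.single s)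
      = prism (cosetPoint H s) (n + 1) (fun y => F.1 y (FinL1.single s)) x :=
  FinL1.lift_single _ _ (norm_prism_eval_le H ρ F x) _

variable [Fintype ι]

theorem cocycle_cosetPoint_sub (H : ι → Subgroup G) (ρ : IsomRep G V) {n : ℕ}
    (F : BddCochain (IsomRep.bHom (FinL1.perm (S := CosetUnion H)) ρ) n)
    (hF : coboundary _ n F = 0) (x : Fin (n + 1) → G) (s : CosetUnion H) :
    (shapiroCochainMap H ρ n (baseRestrict H ρ F)).1 x (FinL1.single s)
      - F.1 x (FinL1.single s)
      = simplexCoboundary n (prism (cosetPoint H s) n fun y => F.1 y (FinL1.single s)) x := by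
  have h := prism_homotopy (cosetPoint H s) n (fun y => F.1 y (FinL1.single s)) x
  have h0 : simplexCoboundary (n + 1) (fun y => F.1 y (FinL1.single s)) = fun _ => 0 := by
    funext y
    have := congrArg (fun F' => F'.1 y (FinL1.single s)) hF
    simp only [coboundary_apply, BddCochain.zero_val, sum_apply] at this
    exact this
  rw [h0, prism_zero, add_zero] at h
  rw [shapiroCochainMap_single, shapiroFun_baseRestrict, h]

theorem shapiroCochainMap_baseRestrict_sub_mem (H : ι → Subgroup G) (ρ : IsomRep G V) {n : ℕ}
    (F : BddCochain (IsomRep.bHom (FinL1.perm (S := CosetUnion H)) ρ) n)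
    (hF : coboundary _ n F = 0) :
    shapiroCochainMap H ρ n (baseRestrict H ρ F) - F ∈ bddCoboundaries _ n := by
  cases n with
  | zero =>
    -- In degree zero the coboundaries are `⊥`, so actual equality is needed; it holds because the
    -- prism operator vanishes there.
    change _ = _
    refine BddCochain.ext fun x => FinL1.hom_ext fun s => ?_
    refine (cocycle_cosetPoint_sub H ρ F hF x s).trans ?_
    simp [simplexCoboundary, prism, BddCochain.zero_val]
  | succ n =>
    refine ⟨shapiroHomotopy H ρ F, BddCochain.ext fun x => FinL1.hom_ext fun s => ?_⟩
    refine Eq.trans ?_ (cocycle_cosetPoint_sub H ρ F hF x s).symm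
    rw [coboundary_apply, sum_apply]
    refine Finset.sum_congr rfl fun i _ => ?_
    rw [smul_apply, shapiroHomotopy_single]

theorem shapiroCochainMap_mem_bddCocycles (H : ι → Subgroup G) (ρ : IsomRep G V) (n : ℕ)
    (c : ∀ i, bddCocycles (ρ.res (H i)) n) :
    shapiroCochainMap H ρ n (fun i => (c i).1) ∈ bddCocycles _ n := by
  change coboundary _ n _ = 0
  rw [← shapiroCochainMap_coboundary, ← map_zero (shapiroCochainMap H ρ (n + 1))]
  exact congrArg _ (funext fun i => (c i).2)

/-- `shapiroMap` is defined factor by factor; additivity of the cochain map reassembles the family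
from its one-coordinate pieces. -/
theorem shapiroMap_mk (H : ι → Subgroup G) (ρ : IsomRep G V) (n : ℕ)
    (c : ∀ i, bddCocycles (ρ.res (H i)) n) :
    shapiroMap H ρ n (fun i => Submodule.Quotient.mk (c i))
      = Submodule.Quotient.mk ⟨_, shapiroCochainMap_mem_bddCocycles H ρ n c⟩ := by
  classical
  unfold shapiroMap
  rw [LinearMap.sum_apply]
  have key : ∀ i, shapiroCochainMap H ρ n (Pi.single i (c i).1) ∈ bddCocycles _ n := fun i => by
    change coboundary _ n _ = 0
    rw [← shapiroCochainMap_coboundary, ← coboundary_single,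
      show coboundary _ n (c i).1 = 0 from (c i).2, Pi.single_zero, map_zero]
  refine (Finset.sum_congr rfl (g := fun i => Submodule.mkQ _ ⟨_, key i⟩) fun i _ => ?_).trans ?_
  · refine congrArg Submodule.Quotient.mk (Subtype.ext ?_)
    change shapiroCochainMap H ρ n _ = shapiroCochainMap H ρ n _
    congr 1
  · rw [← map_sum]
    refine congrArg Submodule.Quotient.mk (Subtype.ext ?_)
    rw [Submodule.coe_sum]
    change (∑ i, shapiroCochainMap H ρ n (Pi.single i (c i).1)) = _
    rw [← map_sum, Finset.univ_sum_single]

theorem shapiroMap_surjective (H : ι → Subgroup G) (ρ : IsomRep G V) (n : ℕ) :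
    Function.Surjective (shapiroMap H ρ n) := by
  intro y
  obtain ⟨⟨F, hF⟩, rfl⟩ := Submodule.Quotient.mk_surjective _ y
  have hF' : coboundary _ n F = 0 := hF
  have hc : ∀ i, baseRestrict H ρ F i ∈ bddCocycles (ρ.res (H i)) n := fun i => by
    change coboundary _ n _ = 0
    rw [coboundary_baseRestrict, hF']
    rfl
  refine ⟨fun i => Submodule.Quotient.mk ⟨_, hc i⟩, ?_⟩
  rw [shapiroMap_mk, Submodule.Quotient.eq]
  exact shapiroCochainMap_baseRestrict_sub_mem H ρ F hF'

end Shapiro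


/-! ### Equivariant extension of bounded maps from `Δ` -/

namespace FinL1

variable {S : Type*}

theorem norm_augmentation_le (f : FinL1 S) : ‖augmentation S f‖ ≤ ‖f‖ := by
  rw [augmentation_apply, norm_def]
  exact norm_sum_le _ _

/-- The augmentation as a bounded linear functional. -/
def augmentationL (S : Type*) : FinL1 S →L[ℂ] ℂ :=
  (augmentation S).mkContinuous 1 fun f => by rw [one_mul]; exact norm_augmentation_le f

theorem augmentation_single (s : S) : augmentation S (single s) = 1 := by
  rw [augmentation_apply]
  change (Finsupp.single s (1 : ℂ)).sum (fun _ c => c) = 1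
  rw [Finsupp.sum_single_index rfl]

theorem enorm_eq_tsum (f : FinL1 S) : ‖f‖ₑ = ∑' s, ‖f.fn s‖ₑ := by
  rw [tsum_eq_sum (s := f.fn.support) fun s hs => by simpa using hs, ← ofReal_norm, norm_def,
    Finsupp.sum, ENNReal.ofReal_sum_of_nonneg fun _ _ => norm_nonneg _]
  simp only [ofReal_norm]

/-- The pushforward `ℂK → ℂS` along a map `K → S`. -/
def map {K : Type*} (q : K → S) : FinL1 K →L[ℂ] FinL1 S :=
  lift (fun k => single (q k)) 1 fun _ => (norm_single _).le

theorem map_single {K : Type*} (q : K → S) (k : K) : map q (single k) = single (q k) :=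
  lift_single _ _ _ _

theorem norm_map_le {K : Type*} (q : K → S) (x : FinL1 K) : ‖map q x‖ ≤ ‖x‖ := by
  refine ((map q).le_of_opNorm_le (norm_lift_le _ _ _) x).trans_eq ?_
  rw [max_eq_left zero_le_one, one_mul]

theorem augmentation_map {K : Type*} (q : K → S) (x : FinL1 K) :
    augmentation S (map q x) = augmentation K x := by
  have h : (augmentationL S) ∘L map q = augmentationL K := by
    refine hom_ext fun k => ?_
    change augmentation S (map q (single k)) = augmentation K (single k)
    rw [map_single, augmentation_single, augmentation_single]
  exact congrArg (fun T : FinL1 K →L[ℂ] ℂ => T x) h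

theorem map_perm {G K : Type*} [Group G] [MulAction G K] [MulAction G S] (q : K → S)
    (hq : ∀ (g : G) k, q (g • k) = g • q k) (g : G) (x : FinL1 K) :
    map q (perm g x) = perm g (map q x) := by
  have h : map q ∘L ((perm (S := K) g).toContinuousLinearEquiv : FinL1 K →L[ℂ] FinL1 K)
      = ((perm (S := S) g).toContinuousLinearEquiv : FinL1 S →L[ℂ] FinL1 S) ∘L map q := by
    refine hom_ext fun k => ?_
    change map q (perm g (single k)) = perm g (map q (single k))
    rw [perm_single, map_single, map_single, perm_single, hq]
  exact congrArg (fun T : FinL1 K →L[ℂ] FinL1 S => T x) h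

/-- The bounded map `ℂS → Δ`, `x ↦ x - ε(x) b`, for `b` with `ε(b) = 1`. -/
def deltaProj (b : FinL1 S) (hb : augmentation S b = 1) : FinL1 S →L[ℂ] Delta S :=
  (ContinuousLinearMap.id ℂ (FinL1 S) - (augmentationL S).smulRight b).codRestrict (Delta S)
    fun x => by
      change augmentation S (x - augmentation S x • b) = 0
      rw [map_sub, map_smul, hb, smul_eq_mul, mul_one, sub_self]

theorem deltaProj_coe (b : FinL1 S) (hb : augmentation S b = 1) (x : FinL1 S) :
    (deltaProj b hb x : FinL1 S) = x - augmentation S x • b := rfl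

theorem norm_deltaProj_le (b : FinL1 S) (hb : augmentation S b = 1) (hb' : ‖b‖ ≤ 1)
    (x : FinL1 S) : ‖deltaProj b hb x‖ ≤ 2 * ‖x‖ := by
  change ‖x - augmentation S x • b‖ ≤ _
  refine (norm_sub_le _ _).trans ?_
  rw [norm_smul, two_mul]
  have h := mul_le_mul (norm_augmentation_le x) hb' (norm_nonneg _) (norm_nonneg _)
  linarith

end FinL1

/-- Banach-Alaoglu. With an ultrafilter, every bounded family converges along the same filter, so
limits of different families can be added and compared without extracting subnets. -/
theorem exists_weakStar_limit {E α : Type*} [NormedAddCommGroup E] [NormedSpace ℂ E]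
    (U : Ultrafilter α) (u : α → E →L[ℂ] ℂ) (C : ℝ) (hu : ∀ m, ‖u m‖ ≤ C) :
    ∃ v : E →L[ℂ] ℂ, ‖v‖ ≤ C ∧ ∀ e, Tendsto (fun m => u m e) U (𝓝 (v e)) := by
  obtain ⟨v, hv, hlim⟩ := (WeakDual.isCompact_closedBall (𝕜 := ℂ) (0 : StrongDual ℂ E) C
    ).ultrafilter_le_nhds (U.map fun m => StrongDual.toWeakDual (u m)) (by
      rw [le_principal_iff]
      refine Filter.Eventually.of_forall (f := (U : Filter α)) fun m => ?_
      rw [Set.mem_preimage, mem_closedBall_zero_iff]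
      exact hu m)
  refine ⟨WeakDual.toStrongDual v, by simpa using hv, fun e => ?_⟩
  exact ((WeakDual.eval_continuous e).tendsto v).comp hlim

theorem exists_boundedBilinear {A X V : Type*} [NormedAddCommGroup A] [NormedSpace ℂ A]
    [NormedAddCommGroup X] [NormedSpace ℂ X] [NormedAddCommGroup V] [NormedSpace ℂ V]
    (v : A → X → V) (C : ℝ) (hv : ∀ a x, ‖v a x‖ ≤ C * ‖a‖ * ‖x‖)
    (hadd : ∀ a a' x, v (a + a') x = v a x + v a' x) (hsmul : ∀ (c : ℂ) a x, v (c • a) x = c • v a x)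
    (hadd' : ∀ a x x', v a (x + x') = v a x + v a x')
    (hsmul' : ∀ (c : ℂ) a x, v a (c • x) = c • v a x) :
    ∃ σ : A →L[ℂ] (X →L[ℂ] V), ∀ a x, σ a x = v a x :=
  ⟨LinearMap.mkContinuous₂ (LinearMap.mk₂ ℂ v hadd hsmul hadd' hsmul') C hv, fun _ _ => rfl⟩

section Extension

variable {G S E : Type*} [Group G] [MulAction G S] [NormedAddCommGroup E] [NormedSpace ℂ E]

/-- The extension is the weak-* limit of `φ (x - ε(x) b m)` along one ultrafilter. On `Δ` the
sequence is constant. Equivariance holds in the limit because `g (x - ε(x) b m)` and `g x - ε(g x) b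
m` differ by `ε(x) (b m - g b m)`. -/
theorem exists_equivariant_extension (ρ : IsomRep G E) (b : ℕ → FinL1 S)
    (hb : ∀ m, FinL1.augmentation S (b m) = 1) (hb' : ∀ m, ‖b m‖ ≤ 1)
    (hinv : ∀ g : G, Tendsto (fun m => ‖b m - FinL1.perm g (b m)‖) atTop (𝓝 0)) :
    ∃ σ : (FinL1.Delta S →L[ℂ] (E →L[ℂ] ℂ)) →L[ℂ] (FinL1 S →L[ℂ] (E →L[ℂ] ℂ)),
      (∀ (g : G) φ, σ (IsomRep.bHom FinL1.permDelta ρ.dual g φ)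
        = IsomRep.bHom FinL1.perm ρ.dual g (σ φ)) ∧
      ∀ φ (d : FinL1.Delta S), σ φ d = φ d := by
  let U : Ultrafilter ℕ := Ultrafilter.of atTop
  have hU : (U : Filter ℕ) ≤ atTop := Ultrafilter.of_le _
  have hex : ∀ (φ : FinL1.Delta S →L[ℂ] (E →L[ℂ] ℂ)) (x : FinL1 S), ∃ v : E →L[ℂ] ℂ,
      ‖v‖ ≤ ‖φ‖ * (2 * ‖x‖) ∧
      ∀ e, Tendsto (fun m => φ (FinL1.deltaProj (b m) (hb m) x) e) U (𝓝 (v e)) := fun φ x =>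
    exists_weakStar_limit U (fun m => φ (FinL1.deltaProj (b m) (hb m) x)) _ fun m =>
      (φ.le_opNorm _).trans (mul_le_mul_of_nonneg_left
        (FinL1.norm_deltaProj_le _ _ (hb' m) x) (norm_nonneg φ))
  choose v hv hlim using hex
  -- All properties of the extension, bilinearity included, are read off from uniqueness of weak-*
  -- limits.
  have huniq : ∀ φ x (v' : E →L[ℂ] ℂ),
      (∀ e, Tendsto (fun m => φ (FinL1.deltaProj (b m) (hb m) x) e) U (𝓝 (v' e))) →
      v φ x = v' := fun φ x v' h =>
    ContinuousLinearMap.ext fun e => tendsto_nhds_unique (hlim φ x e) (h e)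
  -- The constant 2 bounds the norm of the projection `x ↦ x - ε(x) b m`.
  obtain ⟨σ, hσ⟩ := exists_boundedBilinear v 2 (fun φ x => (hv φ x).trans_eq (by ring))
      (fun φ φ' x => huniq _ _ _ fun e => by
        simpa only [add_apply] using (hlim φ x e).add (hlim φ' x e))
      (fun c φ x => huniq _ _ _ fun e => by
        simpa only [smul_apply] using (hlim φ x e).const_smul c)
      (fun φ x x' => huniq _ _ _ fun e => by
        simpa only [map_add, add_apply] using (hlim φ x e).add (hlim φ x' e))
      (fun c φ x => huniq _ _ _ fun e => by
        simpa only [map_smul, smul_apply] using (hlim φ x e).const_smul c)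
  refine ⟨σ, ?_, ?_⟩
  · intro g φ
    refine ContinuousLinearMap.ext fun x => ?_
    rw [hσ, IsomRep.bHom_apply, hσ]
    refine huniq _ _ _ fun e => ?_
    rw [IsomRep.dual_apply]
    have h1 := hlim φ (FinL1.perm g⁻¹ x) (ρ g⁻¹ e)
    have h2 : Tendsto (fun m => φ (FinL1.permDelta g⁻¹ (FinL1.deltaProj (b m) (hb m) x)
        - FinL1.deltaProj (b m) (hb m) (FinL1.perm g⁻¹ x)) (ρ g⁻¹ e)) U (𝓝 0) := by
      have h3 := ((hinv g⁻¹).mono_left hU).const_mul (‖φ‖ * ‖x‖ * ‖e‖)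
      rw [mul_zero] at h3
      refine squeeze_zero_norm (fun m => ?_) h3
      have h4 : ‖FinL1.permDelta g⁻¹ (FinL1.deltaProj (b m) (hb m) x)
          - FinL1.deltaProj (b m) (hb m) (FinL1.perm g⁻¹ x)‖
          ≤ ‖x‖ * ‖b m - FinL1.perm g⁻¹ (b m)‖ := by
        change ‖FinL1.perm g⁻¹ (x - FinL1.augmentation S x • b m) - (FinL1.perm g⁻¹ x
          - FinL1.augmentation S (FinL1.perm g⁻¹ x) • b m)‖ ≤ _
        rw [FinL1.augmentation_perm, map_sub, map_smul, sub_sub_sub_cancel_left, ← smul_sub,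
          norm_smul]
        exact mul_le_mul_of_nonneg_right (FinL1.norm_augmentation_le x) (norm_nonneg _)
      refine (ContinuousLinearMap.le_opNorm _ _).trans ?_
      rw [LinearIsometryEquiv.norm_map]
      have h5 := (φ.le_opNorm _).trans (mul_le_mul_of_nonneg_left h4 (norm_nonneg φ))
      refine (mul_le_mul_of_nonneg_right h5 (norm_nonneg e)).trans_eq (by ring)
    have h6 := h1.add h2
    rw [add_zero] at h6
    refine h6.congr fun m => ?_
    rw [map_sub, sub_apply, add_sub_cancel]
    rfl
  · intro φ d
    rw [hσ]
    refine huniq _ _ _ fun e => ?_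
    have hd : ∀ m, FinL1.deltaProj (b m) (hb m) (d : FinL1 S) = d := fun m => by
      refine Subtype.ext ?_
      rw [FinL1.deltaProj_coe, show FinL1.augmentation S d = 0 from d.2, zero_smul, sub_zero]
    simp only [hd]
    exact tendsto_const_nhds

end Extension

/-! ### Equivariant sections of coefficient maps -/

section Coefficients

variable {G V W : Type*} [Group G] [NormedAddCommGroup V] [NormedSpace ℂ V]
  [NormedAddCommGroup W] [NormedSpace ℂ W]

theorem coeffMap_surjective_of_section (ρ : IsomRep G V) (σ : IsomRep G W) (T : V →L[ℂ] W)
    (hT : ∀ g v, T (ρ g v) = σ g (T v)) (R : W →L[ℂ] V) (hR : ∀ g w, R (σ g w) = ρ g (R w))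
    (hTR : ∀ w, T (R w) = w) (n : ℕ) : Function.Surjective (coeffMap ρ σ T hT n) := by
  intro y
  refine ⟨coeffMap σ ρ R hR n y, ?_⟩
  obtain ⟨f, rfl⟩ := Submodule.Quotient.mk_surjective _ y
  refine congrArg Submodule.Quotient.mk (Subtype.ext (BddCochain.ext fun x => ?_))
  exact hTR _

end Coefficients

/-! ### Reiter sequences -/

/-- Choose the image of one representative in each orbit and propagate it by the action; the
inclusion of stabilizers makes the result independent of the propagating element. -/
theorem exists_equivariant_map {G K S : Type*} [Group G] [MulAction G K] [MulAction G S]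
    (h : ∀ k : K, ∃ s : S, MulAction.stabilizer G k ≤ MulAction.stabilizer G s) :
    ∃ q : K → S, ∀ (g : G) k, q (g • k) = g • q k := by
  choose t ht using h
  let rep : K → K := fun k => (Quotient.mk (MulAction.orbitRel G K) k).out
  have hrep : ∀ k, ∃ g : G, g • rep k = k := fun k =>
    MulAction.mem_orbit_iff.mp (MulAction.orbitRel_apply.mp
      ((MulAction.orbitRel G K).symm (Quotient.mk_out (s := MulAction.orbitRel G K) k)))
  have hrep' : ∀ (g : G) k, rep (g • k) = rep k := fun g k =>
    congrArg Quotient.out (Quotient.sound (s := MulAction.orbitRel G K)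
      (MulAction.orbitRel_apply.mpr (MulAction.mem_orbit k g)))
  choose γ hγ using hrep
  refine ⟨fun k => γ k • t (rep k), fun g k => ?_⟩
  -- Two ways of carrying the representative to `g • k` differ by an element of its stabilizer,
  -- which by `ht` also fixes the chosen image.
  have h1 : ((γ (g • k))⁻¹ * (g * γ k)) • rep k = rep k := by
    rw [mul_smul, mul_smul, hγ, inv_smul_eq_iff, ← hrep' g k, hγ]
  have h2 := ht _ h1
  rw [MulAction.mem_stabilizer_iff, mul_smul, inv_smul_eq_iff, mul_smul] at h2
  change γ (g • k) • t (rep (g • k)) = g • γ k • t (rep k)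
  rw [hrep', h2]

theorem stabilizer_cosetUnion_mk {G ι : Type*} [Group G] (H : ι → Subgroup G) (i : ι) (a : G) :
    MulAction.stabilizer G (⟨i, (a : G ⧸ H i)⟩ : CosetUnion H)
      = (H i).map (MulAut.conj a).toMonoidHom := by
  ext g
  rw [MulAction.mem_stabilizer_iff, Subgroup.mem_map]
  have e : g • (⟨i, (a : G ⧸ H i)⟩ : CosetUnion H) = ⟨i, ((g * a : G) : G ⧸ H i)⟩ := rfl
  rw [e]
  constructor
  · intro h
    have h' : ((g * a : G) : G ⧸ H i) = a := by simpa using h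
    refine ⟨a⁻¹ * (g * a), QuotientGroup.eq.mp h'.symm, ?_⟩
    simp [MulAut.conj_apply, mul_assoc]
  · rintro ⟨h, hh, rfl⟩
    congr 1
    refine (QuotientGroup.eq.mpr ?_).symm
    simpa [MulAut.conj_apply, mul_assoc] using hh

/-- A sequence in `ℂK` of elements of norm at most one and augmentation one that is asymptotically
invariant. -/
def IsReiterSeq (G : Type*) {K : Type*} [Group G] [MulAction G K] (a : ℕ → FinL1 K) : Prop :=
  (∀ m, FinL1.augmentation K (a m) = 1) ∧ (∀ m, ‖a m‖ ≤ 1) ∧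
    ∀ g : G, Tendsto (fun m => ‖a m - FinL1.perm g (a m)‖) atTop (𝓝 0)

theorem IsReiterSeq.map {G K S : Type*} [Group G] [MulAction G K] [MulAction G S]
    {a : ℕ → FinL1 K} (ha : IsReiterSeq G a) (q : K → S)
    (hq : ∀ (g : G) k, q (g • k) = g • q k) : IsReiterSeq G fun m => FinL1.map q (a m) := by
  refine ⟨fun m => ?_, fun m => (FinL1.norm_map_le _ _).trans (ha.2.1 m), fun g => ?_⟩
  · exact (FinL1.augmentation_map q (a m)).trans (ha.1 m)
  · refine squeeze_zero (fun _ => norm_nonneg _) (fun m => ?_) (ha.2.2 g)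
    rw [← FinL1.map_perm q hq, ← map_sub]
    exact FinL1.norm_map_le _ _

/-- Over a point the supremum in `VNorm` has one term, so it is the `ℓ¹`-norm of the values there.
-/
theorem exists_isReiterSeq {G K : Type*} [Group G] [MulAction G K] (f : ℕ → K → C(PUnit.{1}, ℝ))
    (hfin : ∀ n, (Function.support (f n)).Finite) (hpos : ∀ n k x, 0 ≤ f n k x)
    (hsum : ∀ n x, ∑ᶠ k, f n k x = 1)
    (hlim : ∀ g : G, Tendsto (fun n => VNorm (f n - VTranslate g (f n))) atTop (𝓝 0)) :
    ∃ a : ℕ → FinL1 K, IsReiterSeq G a := by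
  have hfin' : ∀ n, (Function.support fun k => ((f n k PUnit.unit : ℝ) : ℂ)).Finite := fun n =>
    (hfin n).subset fun k hk => by
      intro h0
      exact hk (by simp [h0])
  let a : ℕ → FinL1 K := fun n => FinL1.of (Finsupp.ofSupportFinite _ (hfin' n))
  have ha : ∀ n k, (a n).fn k = ((f n k PUnit.unit : ℝ) : ℂ) := fun n k => rfl
  have hone : ∀ n, ∑ k ∈ (a n).fn.support, f n k PUnit.unit = 1 := fun n => by
    rw [← hsum n PUnit.unit]
    refine (finsum_eq_sum_of_support_subset _ fun k hk => ?_).symm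
    rw [Finset.mem_coe, Finsupp.mem_support_iff, ha]
    exact_mod_cast hk
  refine ⟨a, fun n => ?_, fun n => ?_, fun g => ?_⟩
  · rw [FinL1.augmentation_apply, Finsupp.sum]
    simp only [ha]
    exact_mod_cast hone n
  · rw [FinL1.norm_def, Finsupp.sum]
    simp only [ha, Complex.norm_real, Real.norm_eq_abs, abs_of_nonneg (hpos _ _ _)]
    exact (hone n).le
  · refine tendsto_zero_iff_norm_tendsto_zero.mp
      (tendsto_zero_iff_enorm_tendsto_zero.mpr ((hlim g).congr fun n => ?_))
    rw [FinL1.enorm_eq_tsum, VNorm, ciSup_unique]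
    refine tsum_congr fun k => ?_
    have e : (a n - FinL1.perm g (a n)).fn k
        = ((f n k PUnit.unit - f n (g⁻¹ • k) PUnit.unit : ℝ) : ℂ) := by
      rw [Complex.ofReal_sub, ← ha, ← ha, FinL1.fn, map_sub]
      rfl
    rw [e, ← ofReal_norm, ← ofReal_norm, Complex.norm_real]
    rfl

/-- The Reiter sequence lives on `K`. The stabilizer of each point of `K` is also the stabilizer of
some coset, so there is an equivariant map to `G/𝓗` along which the sequence can be pushed forward.
-/
theorem connectingMap_surjective_of_isRelAmenable {G ι E : Type*} [Group G] [Fintype ι]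
    (H : ι → Subgroup G) (hH : IsRelAmenable H) [NormedAddCommGroup E] [NormedSpace ℂ E]
    (ρ : IsomRep G E) (n : ℕ) : Function.Surjective (connectingMap H ρ.dual n) := by
  obtain ⟨K, _, ⟨-, -, hK⟩, f, hfin, hpos, hsum, hlim⟩ := hH
  obtain ⟨a, ha⟩ := exists_isReiterSeq f hfin hpos hsum hlim
  obtain ⟨q, hq⟩ := exists_equivariant_map (G := G) (K := K) (S := CosetUnion H) fun k => by
    obtain ⟨i, g, h⟩ : MulAction.stabilizer G k ∈ {L | ∃ i, ∃ g : G,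
      L = (H i).map (MulAut.conj g).toMonoidHom} := hK ▸ Set.mem_range_self k
    exact ⟨⟨i, (g : G ⧸ H i)⟩, by rw [stabilizer_cosetUnion_mk, h]⟩
  obtain ⟨hb1, hb2, hb3⟩ := ha.map q hq
  obtain ⟨σ, hσ, hσ'⟩ := exists_equivariant_extension ρ _ hb1 hb2 hb3
  unfold connectingMap
  rw [LinearMap.coe_comp]
  refine Function.Surjective.comp ?_ (shapiroMap_surjective H ρ.dual n)
  exact coeffMap_surjective_of_section _ _ _ _ σ hσ
    (fun φ => ContinuousLinearMap.ext fun d => hσ' φ d) n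


/-! ### Almost invariant vectors from an equivariant extension -/

/-- Hahn-Banach, applied to the quotient by the closure of `W`: a nonzero class there is detected by
a bounded functional. -/
theorem Submodule.mem_closure_of_forall_dual {Y : Type*} [NormedAddCommGroup Y] [NormedSpace ℂ Y]
    (W : Submodule ℂ Y) (y : Y) (h : ∀ f : Y →L[ℂ] ℂ, (∀ w ∈ W, f w = 0) → f y = 0) :
    y ∈ closure (W : Set Y) := by
  by_contra hy
  have hcl : IsClosed (W.topologicalClosure : Set Y) := W.isClosed_topologicalClosure
  have hne : W.topologicalClosure.mkQL y ≠ 0 := by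
    intro h0
    exact hy ((Submodule.Quotient.mk_eq_zero _).mp h0)
  obtain ⟨f, hf⟩ := SeparatingDual.exists_ne_zero (R := ℂ) hne
  refine hf (h (f ∘L W.topologicalClosure.mkQL) fun w hw => ?_)
  have h0 : W.topologicalClosure.mkQL w = 0 :=
    (Submodule.Quotient.mk_eq_zero _).mpr (W.le_topologicalClosure hw)
  rw [ContinuousLinearMap.comp_apply, h0, map_zero]

theorem FinL1.single_sub_single_mem {K : Type*} (k l : K) :
    FinL1.single k - FinL1.single l ∈ FinL1.Delta K := by
  change FinL1.augmentation K _ = 0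
  rw [map_sub, FinL1.augmentation_single, FinL1.augmentation_single, sub_self]

/-- Namioka's trick: one seeks `d ∈ Δ` with `(d - g d)_g` close to `(δ_{k₀} - g δ_{k₀})_g`, so that
`x = δ_{k₀} - d` is almost invariant with augmentation one. By Hahn-Banach it suffices that every
functional vanishing on the first kind of vectors vanishes on the second, and the equivariant family
`v` proves this by evaluation at `k₀`. -/
theorem exists_almost_invariant {G K : Type*} [Group G] [MulAction G K] (k₀ : K)
    (v : K → (FinL1.Delta K →L[ℂ] ℂ) →ₗ[ℂ] ℂ)
    (hv : ∀ (g : G) k u, v (g • k) u = v k (IsomRep.dual FinL1.permDelta g⁻¹ u))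
    (hdiff : ∀ k l u, v k u - v l u = u ⟨_, FinL1.single_sub_single_mem k l⟩)
    (T : Finset G) {ε : ℝ} (hε : 0 < ε) :
    ∃ x : FinL1 K, FinL1.augmentation K x = 1 ∧ ∀ g ∈ T, ‖x - FinL1.perm g x‖ < ε := by
  classical
  let L : FinL1 K →L[ℂ] (T → FinL1 K) := ContinuousLinearMap.pi fun g =>
    ContinuousLinearMap.id ℂ (FinL1 K)
      - ((FinL1.perm (S := K) (g : G)).toContinuousLinearEquiv : FinL1 K →L[ℂ] FinL1 K)
  have hL : ∀ x g, L x g = x - FinL1.perm (g : G) x := fun x g => rfl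
  have hcl : L (FinL1.single k₀)
      ∈ closure (((FinL1.Delta K).map (L : FinL1 K →ₗ[ℂ] (T → FinL1 K)) :
        Submodule ℂ (T → FinL1 K)) : Set (T → FinL1 K)) := by
    refine Submodule.mem_closure_of_forall_dual _ _ fun f hf => ?_
    have hsum : ∀ y : T → FinL1 K,
        f y = ∑ g, f (ContinuousLinearMap.single ℂ (fun _ : T => FinL1 K) g (y g)) := fun y => by
      rw [← map_sum]
      congr 1
      exact (Finset.univ_sum_single y).symm
    -- The restrictions to `Δ` of the components of `f`; vanishing of `f` on the image of `Δ`
    -- becomes the relation `hμ`.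
    let μ : T → (FinL1.Delta K →L[ℂ] ℂ) := fun g =>
      (f ∘L ContinuousLinearMap.single ℂ (fun _ : T => FinL1 K) g) ∘L (FinL1.Delta K).subtypeL
    have hμ : ∑ g, (μ g - IsomRep.dual FinL1.permDelta (g : G)⁻¹ (μ g)) = 0 := by
      refine ContinuousLinearMap.ext fun d => ?_
      have h := hf (L d) (Submodule.mem_map_of_mem d.2)
      rw [hsum] at h
      rw [sum_apply]
      refine (Finset.sum_congr rfl fun g _ => ?_).trans h
      rw [sub_apply, IsomRep.dual_apply, ← map_sub, inv_inv]
      rfl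
    -- The differences `δ_{k₀} - g δ_{k₀}` lie in `Δ`, so `hdiff` applies; by equivariance the sum
    -- is then `v k₀` applied to the left side of `hμ`.
    have hk : f (L (FinL1.single k₀))
        = ∑ g, (v k₀ (μ g) - v ((g : G) • k₀) (μ g)) := by
      rw [hsum]
      refine Finset.sum_congr rfl fun g _ => ?_
      rw [hdiff, hL, FinL1.perm_single]
      rfl
    rw [hk]
    simp only [hv, ← map_sub]
    rw [← map_sum, hμ, map_zero]
  obtain ⟨_, ⟨d, hd, rfl⟩, hdist⟩ := Metric.mem_closure_iff.mp hcl ε hε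
  refine ⟨FinL1.single k₀ - d, ?_, fun g hg => ?_⟩
  · rw [map_sub, FinL1.augmentation_single, show FinL1.augmentation K d = 0 from hd, sub_zero]
  · rw [← hL _ ⟨g, hg⟩, map_sub]
    rw [dist_eq_norm] at hdist
    exact (norm_le_pi_norm _ _).trans_lt hdist

/-! ### From almost invariant vectors to relative amenability -/

/-- The normalised absolute value of an element of `ℂK`, as a function on `K` with values in the
continuous functions on a point. -/
def FinL1.normalizedAbs {K : Type*} (x : FinL1 K) (k : K) : C(PUnit.{1}, ℝ) :=
  ContinuousMap.const _ (‖x.fn k‖ / ‖x‖)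

theorem FinL1.support_normalizedAbs {K : Type*} (x : FinL1 K) :
    Function.support x.normalizedAbs ⊆ x.fn.support := by
  intro k hk
  rw [Finset.mem_coe, Finsupp.mem_support_iff]
  intro h0
  refine hk (ContinuousMap.ext fun _ => ?_)
  simp [normalizedAbs, h0]

theorem FinL1.finsum_normalizedAbs {K : Type*} (x : FinL1 K) (hx : x ≠ 0) (p : PUnit.{1}) :
    ∑ᶠ k, x.normalizedAbs k p = 1 := by
  rw [finsum_eq_sum_of_support_subset (s := x.fn.support) _ fun k hk =>
    x.support_normalizedAbs fun h0 => hk (by simp [h0])]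
  simp only [normalizedAbs, ContinuousMap.const_apply]
  rw [← Finset.sum_div]
  exact div_self (norm_ne_zero_iff.mpr hx)

/-- The reverse triangle inequality at each point; dividing by `‖x‖ ≥ 1` only decreases the result.
-/
theorem FinL1.vNorm_normalizedAbs_sub_le {G K : Type*} [Group G] [MulAction G K]
    [MulAction G PUnit.{1}] [ContinuousConstSMul G PUnit.{1}] (x : FinL1 K)
    (hx : 1 ≤ ‖x‖) (g : G) :
    VNorm (x.normalizedAbs - VTranslate g x.normalizedAbs) ≤ ‖x - perm g x‖ₑ := by
  rw [enorm_eq_tsum, VNorm, ciSup_unique]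
  refine ENNReal.tsum_le_tsum fun k => enorm_le_iff_norm_le.mpr ?_
  have e : (x - perm g x).fn k = x.fn k - x.fn (g⁻¹ • k) := by
    rw [fn, map_sub]
    rfl
  change ‖‖x.fn k‖ / ‖x‖ - ‖x.fn (g⁻¹ • k)‖ / ‖x‖‖ ≤ _
  rw [e, ← sub_div, norm_div, norm_norm]
  refine (div_le_self (norm_nonneg _) hx).trans ?_
  exact abs_norm_sub_norm_le _ _

theorem countable_cosetUnion {G ι : Type*} [Group G] [Countable G] [Countable ι]
    (H : ι → Subgroup G) : Countable (CosetUnion H) :=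
  haveI : ∀ i, Countable (G ⧸ H i) := fun _ => QuotientGroup.mk_surjective.countable
  inferInstance

theorem isAdaptedSet_of_equiv {G ι K : Type*} [Group G] [Countable G] [Finite ι]
    [MulAction G K] (H : ι → Subgroup G) (e : CosetUnion H ≃ K)
    (he : ∀ (g : G) s, e (g • s) = g • e s) : IsAdaptedSet H K := by
  have hstab : ∀ s, MulAction.stabilizer G (e s) = MulAction.stabilizer G s := fun s => by
    ext g
    rw [MulAction.mem_stabilizer_iff, MulAction.mem_stabilizer_iff, ← he, e.apply_eq_iff_eq]
  have := countable_cosetUnion H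
  refine ⟨e.symm.injective.countable, ?_, ?_⟩
  · refine Finite.of_surjective (fun i : ι => (Quotient.mk (MulAction.orbitRel G K)
      (e ⟨i, ((1 : G) : G ⧸ H i)⟩))) fun y => ?_
    obtain ⟨k, rfl⟩ := Quotient.exists_rep y
    obtain ⟨⟨i, z⟩, rfl⟩ := e.surjective k
    obtain ⟨a, rfl⟩ := QuotientGroup.mk_surjective z
    refine ⟨i, Quotient.sound (s := MulAction.orbitRel G K) ?_⟩
    refine (MulAction.orbitRel G K).symm (MulAction.orbitRel_apply.mpr
      (MulAction.mem_orbit_iff.mpr ⟨a, ?_⟩))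
    rw [← he]
    refine congrArg e ?_
    change (⟨i, ((a * 1 : G) : G ⧸ H i)⟩ : CosetUnion H) = _
    rw [mul_one]
  · ext M
    constructor
    · rintro ⟨k, rfl⟩
      obtain ⟨⟨i, z⟩, rfl⟩ := e.surjective k
      obtain ⟨a, rfl⟩ := QuotientGroup.mk_surjective z
      exact ⟨i, a, by rw [hstab, stabilizer_cosetUnion_mk]⟩
    · rintro ⟨i, a, rfl⟩
      exact ⟨e ⟨i, (a : G ⧸ H i)⟩, by rw [hstab, stabilizer_cosetUnion_mk]⟩

theorem isRelAmenable_of_almost_invariant {G ι : Type*} {K : Type} [Group G] [Countable G]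
    [MulAction G K] {H : ι → Subgroup G} (hK : IsAdaptedSet H K)
    (h : ∀ (T : Finset G) (ε : ℝ), 0 < ε →
      ∃ x : FinL1 K, FinL1.augmentation K x = 1 ∧ ∀ g ∈ T, ‖x - FinL1.perm g x‖ < ε) :
    IsRelAmenable H := by
  classical
  obtain ⟨γ, hγ⟩ := exists_surjective_nat G
  -- Exhaust the countable group by the finite sets `{γ 0, …, γ n}` with tolerance `1/(n+1)`: each
  -- `g` is controlled from some index on.
  choose x hx1 hx using fun n : ℕ => h ((Finset.range (n + 1)).image γ) (1 / ((n : ℝ) + 1))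
    (by positivity)
  have hnorm : ∀ n, 1 ≤ ‖x n‖ := fun n => by
    simpa [hx1] using FinL1.norm_augmentation_le (x n)
  refine ⟨K, inferInstance, hK, fun n => (x n).normalizedAbs,
    fun n => (Finset.finite_toSet _).subset (x n).support_normalizedAbs,
    fun n k p => div_nonneg (norm_nonneg _) (norm_nonneg _),
    fun n p => (x n).finsum_normalizedAbs
      (norm_pos_iff.mp (zero_lt_one.trans_le (hnorm n))) p, fun g => ?_⟩
  have hlim : Tendsto (fun n => ‖x n - FinL1.perm g (x n)‖) atTop (𝓝 0) := by
    obtain ⟨m, rfl⟩ := hγ g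
    refine squeeze_zero' (Eventually.of_forall fun _ => norm_nonneg _) ?_
      tendsto_one_div_add_atTop_nhds_zero_nat
    filter_upwards [eventually_ge_atTop m] with n hn
    exact (hx n _ (Finset.mem_image_of_mem γ (Finset.mem_range.mpr (Nat.lt_succ_of_le hn)))).le
  exact tendsto_of_tendsto_of_tendsto_of_le_of_le tendsto_const_nhds
    (tendsto_zero_iff_enorm_tendsto_zero.mp (tendsto_zero_iff_norm_tendsto_zero.mpr hlim))
    (fun _ => zero_le) fun n => (x n).vNorm_normalizedAbs_sub_le (hnorm n) g

/-! ### Degree zero -/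

/-- An invariant `J` is a constant 0-cocycle. A preimage of its class, taken after the Shapiro map,
is represented by a 0-cocycle `F` with values in `bHom(ℂ[G/𝓗], V)`. Since there are no coboundaries
in degree zero, `F` restricts to `J` exactly, and its constant value is an invariant extension. -/
theorem exists_extension_of_connectingMap_surjective {G ι V : Type*} [Group G] [Fintype ι]
    [NormedAddCommGroup V] [NormedSpace ℂ V] (H : ι → Subgroup G) (ρ : IsomRep G V)
    (hsurj : Function.Surjective (connectingMap H ρ 0))
    (J : FinL1.Delta (CosetUnion H) →L[ℂ] V)
    (hJ : ∀ g, IsomRep.bHom FinL1.permDelta ρ g J = J) :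
    ∃ A : FinL1 (CosetUnion H) →L[ℂ] V,
      (∀ g, IsomRep.bHom FinL1.perm ρ g A = A) ∧
      ∀ d : FinL1.Delta (CosetUnion H), A d = J d := by
  let c : BddCochain (IsomRep.bHom (FinL1.permDelta (S := CosetUnion H)) ρ) 0 :=
    ⟨fun _ => J, ⟨‖J‖, fun _ => le_rfl⟩, fun g _ => (hJ g).symm⟩
  have hc : c ∈ bddCocycles _ 0 := by
    refine BddCochain.ext fun x => ?_
    rw [coboundary_apply, Fin.sum_univ_two]
    simp [c, BddCochain.zero_val]
  obtain ⟨y, hy⟩ := hsurj (Submodule.Quotient.mk ⟨c, hc⟩)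
  rw [connectingMap, LinearMap.comp_apply] at hy
  obtain ⟨⟨F, hF⟩, hFy⟩ := Submodule.Quotient.mk_surjective _ (shapiroMap H ρ 0 y)
  rw [← hFy] at hy
  have hmem := (Submodule.Quotient.eq _).mp hy
  have hres : ∀ x (d : FinL1.Delta (CosetUnion H)), F.1 x d = J d := by
    intro x d
    have hzero : ∀ z ∈ bddCoboundaries (IsomRep.bHom (FinL1.permDelta (S := CosetUnion H)) ρ) 0,
        z.1 x d = 0 := by
      intro z hz
      obtain rfl : z = 0 := hz
      rfl
    exact sub_eq_zero.mp (hzero _ hmem)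
  -- The cocycle identity on the edge `(1, g)`. Constancy combined with homogeneity yields
  -- invariance of the value.
  have hconst : ∀ g : G, F.1 (fun _ => g) = F.1 (fun _ => 1) := by
    intro g
    have h0 : coboundary _ 0 F = 0 := hF
    have h1 := (coboundary_apply _ 0 F ![1, g]).symm.trans
      (congrArg (fun f : BddCochain _ 1 => f.1 ![1, g]) h0)
    rw [Fin.sum_univ_two] at h1
    have e0 : (fun j : Fin 1 => (![1, g] : Fin 2 → G) ((0 : Fin 2).succAbove j)) = fun _ => g := by
      funext j
      fin_cases j
      rfl
    have e1 : (fun j : Fin 1 => (![1, g] : Fin 2 → G) ((1 : Fin 2).succAbove j)) = fun _ => 1 := by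
      funext j
      fin_cases j
      rfl
    rw [e0, e1, BddCochain.zero_val] at h1
    simpa [add_neg_eq_zero] using h1
  refine ⟨F.1 fun _ => 1, fun g => ?_, fun d => hres _ d⟩
  rw [← F.2.2, mul_one, hconst]

/-! ### The canonical embedding of `Δ` into its bidual -/

/-- Transport of an isometric action along a linear isometric equivalence. -/
def IsomRep.transport {G V W : Type*} [Group G] [NormedAddCommGroup V] [NormedSpace ℂ V]
    [NormedAddCommGroup W] [NormedSpace ℂ W] (e : W ≃ₗᵢ[ℂ] V) (ρ : IsomRep G V) :
    IsomRep G W where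
  toFun g := (e.trans (ρ g)).trans e.symm
  map_one' := by
    ext1 w
    simp
  map_mul' g h := by
    ext1 w
    simp

/-- The map `Δ → Δ` induced by a map of sets. -/
def FinL1.deltaMap {S K : Type*} (q : S → K) : FinL1.Delta S →L[ℂ] FinL1.Delta K :=
  ((FinL1.map q) ∘L (FinL1.Delta S).subtypeL).codRestrict (FinL1.Delta K) fun d =>
    (FinL1.augmentation_map q d).trans d.2

/-- The evaluation map `d ↦ (u ↦ e u (q d))` into the dual of a space `E` isometric to a dual. -/
def evalDual {D D' E : Type*} [NormedAddCommGroup D] [NormedSpace ℂ D] [NormedAddCommGroup D']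
    [NormedSpace ℂ D'] [NormedAddCommGroup E] [NormedSpace ℂ E] (e : E ≃ₗᵢ[ℂ] (D' →L[ℂ] ℂ))
    (q : D →L[ℂ] D') : D →L[ℂ] (E →L[ℂ] ℂ) :=
  (ContinuousLinearMap.precomp ℂ q ∘L
    (e.toContinuousLinearEquiv : E →L[ℂ] (D' →L[ℂ] ℂ))).flip

/-- The test module is the dual of `Δ`, and `J` is the canonical map from `Δ` into its bidual. Up to
the identifications `e` and `up`, its invariant extension `A` sends basis vectors to functionals `v
k` on `Δ*` permuted by `G`, with `v k - v l` equal to evaluation at `δ_k - δ_l`. This is the input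
of `exists_almost_invariant`. -/
theorem isRelAmenable_of_connectingMap_surjective {G ι E : Type*} {K : Type} [Group G]
    [Countable G] [MulAction G K] [Fintype ι] [Nonempty ι] (H : ι → Subgroup G)
    (e : CosetUnion H ≃ K) (he : ∀ (g : G) s, e (g • s) = g • e s)
    [NormedAddCommGroup E] [NormedSpace ℂ E] (up : E ≃ₗᵢ[ℂ] (FinL1.Delta K →L[ℂ] ℂ))
    (h : Function.Surjective
      (connectingMap H (IsomRep.transport up (IsomRep.dual (FinL1.permDelta (G := G)))).dual 0)) :
    IsRelAmenable H := by
  have he' : ∀ (g : G) k, e.symm (g • k) = g • e.symm k := fun g k => by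
    rw [e.symm_apply_eq, he, e.apply_symm_apply]
  let ρ : IsomRep G E := IsomRep.transport up (IsomRep.dual FinL1.permDelta)
  let J : FinL1.Delta (CosetUnion H) →L[ℂ] (E →L[ℂ] ℂ) := evalDual up (FinL1.deltaMap e)
  have hJ : ∀ d u, J d u = up u (FinL1.deltaMap e d) := fun d u => rfl
  have hρ : ∀ g u, up (ρ g u) = IsomRep.dual FinL1.permDelta g (up u) := fun g u =>
    up.apply_symm_apply _
  have hJinv : ∀ g, IsomRep.bHom FinL1.permDelta ρ.dual g J = J := fun g => by
    refine ContinuousLinearMap.ext fun d => ContinuousLinearMap.ext fun u => ?_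
    rw [IsomRep.bHom_apply, IsomRep.dual_apply, hJ, hJ, hρ, IsomRep.dual_apply, inv_inv]
    refine congrArg (up u) (Subtype.ext ?_)
    change FinL1.perm g (FinL1.map e (FinL1.perm g⁻¹ d)) = FinL1.map e d
    rw [← FinL1.map_perm e he, IsomRep.self_apply_inv]
  obtain ⟨A, hA, hAJ⟩ := exists_extension_of_connectingMap_surjective H ρ.dual h J hJinv
  have hAsmul : ∀ (g : G) s u, A (FinL1.single (g • s)) u = A (FinL1.single s) (ρ g⁻¹ u) := by
    intro g s u
    conv_lhs => rw [← hA g]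
    rw [IsomRep.bHom_apply, FinL1.perm_single, inv_smul_smul, IsomRep.dual_apply]
  let i₀ : ι := Classical.arbitrary ι
  refine isRelAmenable_of_almost_invariant (isAdaptedSet_of_equiv H e he) fun T ε hε =>
    exists_almost_invariant (e ⟨i₀, ((1 : G) : G ⧸ H i₀)⟩)
      (fun k => (A (FinL1.single (e.symm k))).toLinearMap ∘ₗ
        up.symm.toLinearEquiv.toLinearMap) ?_ ?_ T hε
  · intro g k u
    change A (FinL1.single (e.symm (g • k))) (up.symm u) = A (FinL1.single (e.symm k)) _
    have hsymm : ρ g⁻¹ (up.symm u) = up.symm (IsomRep.dual FinL1.permDelta g⁻¹ u) :=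
      up.injective (by rw [hρ, up.apply_symm_apply, up.apply_symm_apply])
    rw [he', hAsmul, hsymm]
    rfl
  · intro k l u
    change A (FinL1.single (e.symm k)) (up.symm u) - A (FinL1.single (e.symm l)) (up.symm u) = _
    rw [← sub_apply, ← map_sub]
    refine (congrArg (fun T : E →L[ℂ] ℂ => T (up.symm u))
      (hAJ ⟨_, FinL1.single_sub_single_mem _ _⟩)).trans ?_
    rw [hJ, up.apply_symm_apply]
    refine congrArg u (Subtype.ext ?_)
    change FinL1.map e (FinL1.single (e.symm k) - FinL1.single (e.symm l)) = _
    rw [map_sub, FinL1.map_single, FinL1.map_single, e.apply_symm_apply, e.apply_symm_apply]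

/-- Relative amenability asks for a `G`-set in `Type`, whereas `G/𝓗` lives in the universes of `G`
and `ι`. A countable type has a copy in `Type`, and the action is carried along. -/
theorem exists_countable_model {G ι : Type*} [Group G] [Countable G] [Countable ι]
    (H : ι → Subgroup G) : ∃ (K : Type) (_ : MulAction G K) (e : CosetUnion H ≃ K),
      ∀ (g : G) s, e (g • s) = g • e s := by
  have := countable_cosetUnion H
  let e : CosetUnion H ≃ Shrink.{0} (CosetUnion H) := equivShrink _
  let _ : MulAction G (Shrink.{0} (CosetUnion H)) := e.symm.mulAction G
  refine ⟨_, inferInstance, e, fun g s => ?_⟩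
  rw [Equiv.smul_def, e.symm_symm, e.symm_apply_apply]

end

/-! ### The equivalence -/

theorem mainTheorem12 {G : Type u} [Group G] [Countable G]
    {ι : Type v} [Fintype ι] [Nonempty ι] (H : ι → Subgroup G) :
    IsRelAmenable H ↔
      ∀ (E : Type w) [NormedAddCommGroup E] [NormedSpace ℂ E] [CompleteSpace E]
        (ρ : IsomRep G E) (n : ℕ), Function.Surjective (connectingMap H ρ.dual n) :=
  ⟨fun hH _ _ _ _ ρ n => connectingMap_surjective_of_isRelAmenable H hH ρ n, fun h => by
    obtain ⟨K, _, e, he⟩ := exists_countable_model H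
    exact isRelAmenable_of_connectingMap_surjective
      -- The test module is complete because it is a dual; `ULift` moves it to the universe `w` of
      -- the coefficients. Surjectivity is used in degree zero only.
      (E := ULift.{w} (FinL1.Delta K →L[ℂ] ℂ)) H e he (LinearIsometryEquiv.ulift ℂ _) (h _ _ 0)⟩
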